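/- Let $Z=(Z_t)_{t\ge 0}$ be a subordinator (a nonnegative process with $Z_0=0$ a.s., independent stationary increments and right-continuous nondecreasing paths) without drift, on a probability space $(\Omega,\mathbb P)$. Let $\rho$ be the Lévy measure of $Z_1$, i.e. the measure on $(0,\infty)$ with $\int (x\wedge 1)\,\rho(dx)<\infty$ and $\mathbb E e^{-uZ_1}=\exp\{-\int(1-e^{-ux})\rho(dx)\}$ for $u\ge 0$, and assume $\kappa:=\mathbb E Z_1\in(0,\infty)$. Let $f:\mathbb R\to[0,\infty)$ be Borel with $f(u)=0$ for $u<0$ and $I(t):=\int_0^t f(s)\,ds<\infty$ for every $t>0$. Put $$\psi(t)=\int_0^t f(t-s)\,dZ_s,\qquad t\ge 0 ,$$ a pathwise Lebesgue–Stieltjes integral, which for each $t$ is a.s. finite. Laws of processes are taken on $\mathbb R_+^{[0,\infty)}$ with the cylindrical $\sigma$-algebra, and $0$ denotes the zero function. The Lévy measure of a nonnegative infinitely divisible process $X=(X(t))_{t\ge 0}$ without drift is the unique measure $\nu$ on $\mathbb R_+^{[0,\infty)}$ such that $\int (y(t)\wedge 1)\,\nu(dy)<\infty$ for all $t$; $\mathbb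 E e^{-\sum_{i}\alpha_i X(t_i)}=\exp\{-\int(1-e^{-\sum_{i}\alpha_i y(t_i)})\,\nu(dy)\}$ for all finite families $t_i\ge0$, $\alpha_i\ge 0$; and $\nu(A)=\sup\{\nu(B): B \text{ measurable},\ B\subset A\setminus\{0\}\}$ for all measurable $A$. The measure $\kappa^{-1}x\,\rho(dx)$ is a probability law; "$V\sim\kappa^{-1}x\,\rho(dx)$" below refers to it. (a3) Let $a>0$ with $I(a)>0$. Then $s\mapsto f(a-s)/I(a)$ is a probability density on $[0,a]$. If $U_a$ has this density, $V\sim\kappa^{-1}x\,\rho(dx)$, and $U_a$, $V$, $\psi$ are independent, then $$\big(\psi(t)+Vf(t-U_a),\ t\ge0\big)\ \text{has the law of}\ \big(\psi(t),\ t\ge 0\big)\ \text{under}\ \frac{\psi(a)}{\kappa I(a)}\,d\mathbb P .$$ (b3) Suppose that $f$ is not a.e. zero and $\int_0^\infty e^{-\theta s}f(s)\,ds<\infty$ for some $\theta>0$. Let $Y$ be exponential with mean $\theta^{-1}$ and independent of $V\sim\kappa^{-1}x\,\rho(dx)$. Then the Lévy measure $\nu$ of $\psi$ exists and is given by $$\int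 F\,d\nu=\frac{\kappa}{\theta}\,\mathbb E\big[V^{-1}e^{\theta Y}F\big(Vf(t-Y),\ t\ge0\big)\big]\quad\text{for every measurable } F\ge 0;$$ that is, $\nu$ is the law of $(Vf(t-Y),\ t\ge 0)$ under $\kappa\theta^{-1}V^{-1}e^{\theta Y}\,d\mathbb P$. (c3) Let $a\ge0$, $D_a=\{s\ge0: f(a-s)=0\}$ and $D_a^c=[0,\infty)\setminus D_a$. By the law of $(\psi\mid\psi(a)=0)$ we mean the limit, in the sense of finite-dimensional distributions, of the conditional laws of $\psi$ given $\psi(a)\le\varepsilon$ (an event of positive probability) as $\varepsilon\downarrow0$; it is the elementary conditional law when $\mathbb P(\psi(a)=0)>0$. This law exists, there is a unique law of a nonnegative process ${\cal L}^{(a)}$, taken independent of $(\psi\mid\psi(a)=0)$, such that $\psi\overset{d}{=}(\psi\mid\psi(a)=0)+{\cal L}^{(a)}$, both components are infinitely divisible, and $$(\psi\mid\psi(a)=0)\overset{d}{=}\Big(\int_0^t f(t-s)1_{D_a}(s)\,dZ_s,\ t\ge0\Big),\qquad {\cal L}^{(a)}\overset{d}{=}\Big(\int_0^t f(t-s)1_{D_a^c}(s)\,dZ_s,\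 t\ge0\Big).$$ If moreover $f$ is not a.e. zero, the Lévy measures $\nu_a$ and $\tilde\nu_a$ of these two processes exist and are given, for every measurable $F\ge0$, by $$\int F\,d\nu_a=\int_{D_a}\!\int_0^\infty F\big(xf(t-s),\,t\ge0\big)\,\rho(dx)\,ds,\qquad \int F\,d\tilde\nu_a=\int_{D_a^c}\!\int_0^\infty F\big(xf(t-s),\,t\ge0\big)\,\rho(dx)\,ds .$$ -/

import Mathlib

open MeasureTheory ProbabilityTheory Filter Set Topology
open scoped NNReal ENNReal

noncomputable section

/-- A subordinator on a probability space: a `[0, ∞)`-valued process started at `0`, with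
independent and stationary increments and right-continuous nondecreasing paths. -/
structure Subordinator {Ω : Type*} [MeasurableSpace Ω] (P : Measure Ω) where
  /-- The value `Z_t(ω)`. -/
  val : ℝ≥0 → Ω → ℝ≥0
  measurable_val : ∀ t, Measurable (val t)
  zero_ae : ∀ᵐ ω ∂P, val 0 ω = 0
  mono : ∀ ω, Monotone fun t => val t ω
  right_cont : ∀ ω t, ContinuousWithinAt (fun t => val t ω) (Ici t) t
  indep : HasIndepIncrements (fun t ω => (val t ω : ℝ)) P
  stationary : ∀ s t : ℝ≥0,
    P.map (fun ω => (val (s + t) ω : ℝ) - val s ω) = P.map (fun ω => (val t ω : ℝ))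

/-- `ρ` is the Lévy measure on `(0, ∞)` of the law `μ` of a nonnegative infinitely divisible
random variable without drift: `μ` has Laplace transform
`u ↦ exp (- ∫ (1 - e^{-u x}) ρ(dx))`. -/
structure IsDriftlessLevyMeasure (ρ μ : Measure ℝ≥0) : Prop where
  zero : ρ {0} = 0
  finite : ∫⁻ x, ((min x 1 : ℝ≥0) : ℝ≥0∞) ∂ρ < ∞
  laplace : ∀ u : ℝ≥0, ∫ z, Real.exp (-((u : ℝ) * z)) ∂μ
    = Real.exp (-∫ x, (1 - Real.exp (-((u : ℝ) * x))) ∂ρ)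

namespace Subordinator

variable {Ω : Type*} [MeasurableSpace Ω] {P : Measure Ω}

/-- The mean `κ = E[Z_1]`. -/
def mean (Z : Subordinator P) : ℝ≥0∞ := ∫⁻ ω, Z.val 1 ω ∂P

/-- The path of `Z` as a Stieltjes function on the line, constant on `(-∞, 0]`. -/
def stieltjes (Z : Subordinator P) (ω : Ω) : StieltjesFunction ℝ where
  toFun s := Z.val s.toNNReal ω
  mono' _ _ h := NNReal.coe_le_coe.2 (Z.mono ω (Real.toNNReal_mono h))
  right_continuous' s := by
    have h1 : ContinuousWithinAt Real.toNNReal (Ici s) s :=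
      continuous_real_toNNReal.continuousWithinAt
    have h2 := (Z.right_cont ω s.toNNReal).comp h1
      (fun r hr => Real.toNNReal_mono hr)
    exact NNReal.continuous_coe.continuousAt.comp_continuousWithinAt h2

/-- The process `t ↦ ∫_0^t f(t - s) 1_D(s) dZ_s`, as a pathwise Lebesgue–Stieltjes integral.
For `f` locally integrable and `E[Z_1] < ∞` the integral is, for each `t`, almost surely finite;
on the exceptional null event the value is set to `0`. -/
def convOn (Z : Subordinator P) (f : ℝ → ℝ≥0) (D : Set ℝ) (t : ℝ≥0) (ω : Ω) : ℝ≥0 :=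
  (∫⁻ s in Ioc 0 (t : ℝ) ∩ D, f (t - s) ∂(Z.stieltjes ω).measure).toNNReal

/-- The stochastic convolution `ψ(t) = ∫_0^t f(t - s) dZ_s`. -/
def conv (Z : Subordinator P) (f : ℝ → ℝ≥0) : ℝ≥0 → Ω → ℝ≥0 := Z.convOn f univ

end Subordinator

/-- The law of a nonnegative process on the space of all functions `E → [0, ∞)` with its
cylindrical σ-algebra. -/
def processLaw {Ω E : Type*} [MeasurableSpace Ω] (P : Measure Ω) (X : E → Ω → ℝ≥0) :
    Measure (E → ℝ≥0) :=
  P.map fun ω x => X x ω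

/-- `ν` is the Lévy measure of the nonnegative infinitely divisible process without drift with
law `μ`. The field `inner` says that `ν(A)` is the inner `ν`-measure of `A` without the
origin, which makes `ν` unique. -/
structure IsProcessLevyMeasure {E : Type*} (ν μ : Measure (E → ℝ≥0)) : Prop where
  finite : ∀ x, ∫⁻ y, ((min (y x) 1 : ℝ≥0) : ℝ≥0∞) ∂ν < ∞
  laplace : ∀ (n : ℕ) (x : Fin n → E) (α : Fin n → ℝ≥0),
    ∫ y, Real.exp (-∑ i, (α i : ℝ) * y (x i)) ∂μ
      = Real.exp (-∫ y, (1 - Real.exp (-∑ i, (α i : ℝ) * y (x i))) ∂ν)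
  inner : ∀ A, MeasurableSet A →
    ν A = ⨆ (B : Set (E → ℝ≥0)) (_ : MeasurableSet B) (_ : B ⊆ A \ {0}), ν B

/-- A law on path space is infinitely divisible if all its finite-dimensional marginals are. -/
def IsInfDivLaw {E : Type*} (μ : Measure (E → ℝ≥0)) : Prop :=
  ∀ (I : Finset E) (n : ℕ), 0 < n → ∃ η : Measure (I → ℝ≥0), IsProbabilityMeasure η ∧
    (Measure.pi fun _ : Fin n => η).map (fun v => ∑ k, v k) = μ.map I.restrict

/-- `Q` is the law of `(ψ | ψ(a) = 0)`, where `μ` is the law of `ψ`: the elementary conditional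
law if `ψ(a) = 0` has positive probability, and in all cases the limit, in the sense of
finite-dimensional distributions, of the conditional laws given `ψ(a) ≤ ε` as `ε ↓ 0`. -/
structure IsCondLawAtZero {E : Type*} (μ : Measure (E → ℝ≥0)) (a : E)
    (Q : Measure (E → ℝ≥0)) : Prop where
  elementary : μ {y | y a = 0} ≠ 0 → Q = ProbabilityTheory.cond μ {y | y a = 0}
  pos : ∀ ε : ℝ≥0, 0 < ε → μ {y | y a ≤ ε} ≠ 0
  limit : ∀ (I : Finset E) (g : BoundedContinuousFunction (I → ℝ≥0) ℝ),
    Tendsto (fun ε : ℝ≥0 => ∫ y, g (I.restrict y) ∂(ProbabilityTheory.cond μ {y | y a ≤ ε}))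
      (𝓝[>] 0) (𝓝 (∫ y, g (I.restrict y) ∂Q))

/-- `I(a) = ∫_0^a f(s) ds`. -/
def primitiveAt (f : ℝ → ℝ≥0) (a : ℝ≥0) : ℝ≥0∞ := ∫⁻ s in Icc 0 (a : ℝ), f s

/-- The law on `[0, a]` with density `s ↦ f(a - s) / I(a)`. -/
def timeLaw (f : ℝ → ℝ≥0) (a : ℝ≥0) : Measure ℝ :=
  (volume.restrict (Icc 0 (a : ℝ))).withDensity fun s => f (a - s) / primitiveAt f a

/-- The law `κ⁻¹ x ρ(dx)`. -/
def sizeBiasedLaw (κ : ℝ≥0∞) (ρ : Measure ℝ≥0) : Measure ℝ≥0 :=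
  κ⁻¹ • ρ.withDensity fun x => (x : ℝ≥0∞)

/-- The path `t ↦ x f(t - s)`, `t ≥ 0`. -/
def shiftPath (f : ℝ → ℝ≥0) (x : ℝ≥0) (s : ℝ) : ℝ≥0 → ℝ≥0 := fun t => x * f (t - s)

/-- `D_a = {s ≥ 0 : f(a - s) = 0}`. -/
def zeroTimes (f : ℝ → ℝ≥0) (a : ℝ≥0) : Set ℝ := {s | 0 ≤ s ∧ f (a - s) = 0}

end

/-!
Expanding the Laplace functional of the random measure `dZ` on step functions, and then by
`L¹`-continuity on all integrable functions, gives
`E exp (-∫ g dZ) = exp (-∫∫ (1 - exp (-x g(s))) ρ(dx) ds)`. Taking `g = 1_D ∑ i, α i f(t i - ·)`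
shows that the image of `1_D(s) ds ρ(dx)` under `(s, x) ↦ x f(· - s)` is a Lévy measure of
`∫ f(t - s) 1_D(s) dZ_s`, and it has no mass at the zero path because translates of `f` detect all
times `s` through countably many `t`.

* Size-biasing. Differentiating the Laplace transform of `ψ` in the variable attached to `ψ(a)`
  gives Palm's formula: `ψ` under `ψ(a) dP` is `ψ` plus an independent path drawn from
  `y(a) ν(dy)`, and `y(a) ν(dy)` is the law of `V f(· - U_a)` up to the constant `κ I(a)`.
* Lévy measure. `ds ρ(dx)` has density `κ θ⁻¹ x⁻¹ e^{θ s}` with respect to the law of `(Y, V)`.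
* Conditioning. Splitting time into `D_a` and its complement splits `ν` and hence writes the law of
  `ψ` as a convolution `Q ∗ R`, where `y(a) = 0` under `Q`. Conditioning on `y(a) ≤ ε` affects `R`
  only, and by Palm's formula the conditional means under `R` are at most
  `∫ y(t) 1{y(a) ≤ ε} ν(dy)`, which tends to `0` as `ν` does not charge `{y(a) = 0}` there.
-/

/-! ### Laplace transforms determine finite measures -/

section LaplaceUniqueness

variable {E ι : Type*} [Fintype ι]

/-- The linear functional `y ↦ ∑ i, α i * y (x i)` on paths, the exponent of the Laplace transform
of a finite-dimensional marginal. -/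
def evalSum (x : ι → E) (α : ι → ℝ≥0) (y : E → ℝ≥0) : ℝ≥0 := ∑ i, α i * y (x i)

theorem coe_evalSum (x : ι → E) (α : ι → ℝ≥0) (y : E → ℝ≥0) :
    (evalSum x α y : ℝ) = ∑ i, (α i : ℝ) * y (x i) := by
  simp [evalSum]

@[fun_prop]
theorem measurable_evalSum (x : ι → E) (α : ι → ℝ≥0) : Measurable (evalSum x α) := by
  unfold evalSum
  fun_prop

theorem evalSum_add (x : ι → E) (α : ι → ℝ≥0) (y z : E → ℝ≥0) :
    evalSum x α (y + z) = evalSum x α y + evalSum x α z := by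
  simp [evalSum, mul_add, Finset.sum_add_distrib]

theorem evalSum_smul (x : ι → E) (α : ι → ℝ≥0) (c : ℝ≥0) (y : E → ℝ≥0) :
    evalSum x α (c • y) = c * evalSum x α y := by
  simp [evalSum, Finset.mul_sum, mul_left_comm]

theorem evalSum_cons {n : ℕ} (x : E) (t : Fin n → E) (u : ℝ≥0) (α : Fin n → ℝ≥0) (y : E → ℝ≥0) :
    evalSum (Fin.cons x t : Fin (n + 1) → E) (Fin.cons u α : Fin (n + 1) → ℝ≥0) y =
      u * y x + evalSum t α y := by
  simp [evalSum, Fin.sum_univ_succ]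

theorem integrable_exp_neg {X : Type*} [MeasurableSpace X] {m : Measure X} [IsFiniteMeasure m]
    {w : X → ℝ≥0} (hw : Measurable w) : Integrable (fun z => Real.exp (-(w z : ℝ))) m :=
  Integrable.of_bound (by fun_prop) 1 (ae_of_all _ fun z => by simp)

/-- The exponential `y ↦ exp (-∑ i, c i * y i)` on the orthant, as an element of the algebra to
which the Stone–Weierstrass theorem is applied. -/
noncomputable def expNegSum (c : ι → ℝ≥0) : BoundedContinuousFunction (ι → ℝ≥0) ℝ :=
  BoundedContinuousFunction.ofNormedAddCommGroup (fun y => Real.exp (-(evalSum id c y : ℝ)))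
    (by unfold evalSum; fun_prop) 1 fun y => by simp

theorem expNegSum_apply (c y : ι → ℝ≥0) :
    expNegSum c y = Real.exp (-(evalSum id c y : ℝ)) := rfl

theorem expNegSum_add (c d : ι → ℝ≥0) : expNegSum (c + d) = expNegSum c * expNegSum d := by
  ext y
  simp [expNegSum_apply, evalSum, add_mul, Finset.sum_add_distrib, Real.exp_add, mul_comm]

theorem expNegSum_zero : expNegSum (0 : ι → ℝ≥0) = 1 := by
  ext y
  simp [expNegSum_apply, evalSum]

variable (ι) in
/-- The linear span of the exponentials `expNegSum c`, which is a subalgebra because products of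
exponentials are exponentials. -/
noncomputable def expSubalgebra : StarSubalgebra ℝ (BoundedContinuousFunction (ι → ℝ≥0) ℝ) :=
  { Submodule.toSubalgebra (Submodule.span ℝ (range (expNegSum (ι := ι))))
      (Submodule.subset_span ⟨0, expNegSum_zero⟩)
      (fun g h hg hh => by
        have hgh := Submodule.mul_mem_mul hg hh
        rw [Submodule.span_mul_span] at hgh
        refine Submodule.span_mono ?_ hgh
        rintro _ ⟨_, ⟨c, rfl⟩, _, ⟨d, rfl⟩, rfl⟩
        exact ⟨c + d, expNegSum_add c d⟩) with
    star_mem' := fun {g} hg => by rwa [show star g = g by ext; simp] }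

theorem expNegSum_mem_expSubalgebra (c : ι → ℝ≥0) : expNegSum c ∈ expSubalgebra ι :=
  Submodule.subset_span ⟨c, rfl⟩

theorem separatesPoints_expSubalgebra :
    ((expSubalgebra ι).map
      (BoundedContinuousFunction.toContinuousMapStarₐ ℝ)).SeparatesPoints := by
  classical
  intro y z hyz
  obtain ⟨i, hi⟩ := Function.ne_iff.1 hyz
  refine ⟨_, ⟨_, ⟨_, expNegSum_mem_expSubalgebra (Pi.single i 1), rfl⟩, rfl⟩, fun h => hi ?_⟩
  change Real.exp _ = Real.exp _ at h
  simpa [evalSum, Pi.single_apply] using h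

theorem integral_eq_of_mem_expSubalgebra {μ ν : Measure (ι → ℝ≥0)} [IsFiniteMeasure μ]
    [IsFiniteMeasure ν] (h : ∀ c, ∫ y, expNegSum c y ∂μ = ∫ y, expNegSum c y ∂ν)
    {g : BoundedContinuousFunction (ι → ℝ≥0) ℝ} (hg : g ∈ expSubalgebra ι) :
    ∫ y, g y ∂μ = ∫ y, g y ∂ν := by
  change g ∈ Submodule.span ℝ (range expNegSum) at hg
  induction hg using Submodule.span_induction with
  | mem _ hg => obtain ⟨c, rfl⟩ := hg; exact h c
  | zero => simp
  | add a b _ _ iha ihb =>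
    simp only [BoundedContinuousFunction.add_apply]
    rw [integral_add (a.integrable μ) (b.integrable μ),
      integral_add (a.integrable ν) (b.integrable ν), iha, ihb]
  | smul r a _ ih =>
    simp only [BoundedContinuousFunction.coe_smul, integral_smul, ih]

theorem ext_of_integral_expNegSum {μ ν : Measure (ι → ℝ≥0)} [IsFiniteMeasure μ]
    [IsFiniteMeasure ν] (h : ∀ c, ∫ y, expNegSum c y ∂μ = ∫ y, expNegSum c y ∂ν) : μ = ν :=
  ext_of_forall_mem_subalgebra_integral_eq_of_polish (𝕜 := ℝ) separatesPoints_expSubalgebra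
    fun _ => integral_eq_of_mem_expSubalgebra h

theorem ext_of_map_restrict {μ ν : Measure (E → ℝ≥0)} [IsFiniteMeasure μ]
    (h : ∀ I : Finset E, μ.map I.restrict = ν.map I.restrict) : μ = ν :=
  IsProjectiveLimit.unique (P := fun I : Finset E => μ.map I.restrict)
    (fun _ => rfl) (fun I => (h I).symm)

theorem evalSum_id_restrict (I : Finset E) (c : I → ℝ≥0) (y : E → ℝ≥0) :
    evalSum id c (I.restrict y) =
      evalSum (fun k => (I.equivFin.symm k : E)) (c ∘ I.equivFin.symm) y :=
  (Equiv.sum_comp I.equivFin.symm fun i => c i * I.restrict y i).symm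

theorem ext_of_laplace {μ ν : Measure (E → ℝ≥0)} [IsFiniteMeasure μ] [IsFiniteMeasure ν]
    (h : ∀ (n : ℕ) (x : Fin n → E) (α : Fin n → ℝ≥0),
      ∫ y, Real.exp (-(evalSum x α y : ℝ)) ∂μ = ∫ y, Real.exp (-(evalSum x α y : ℝ)) ∂ν) :
    μ = ν := by
  refine ext_of_map_restrict fun I => ext_of_integral_expNegSum fun c => ?_
  have hI : Measurable (I.restrict (π := fun _ : E => ℝ≥0)) := Finset.measurable_restrict I
  rw [integral_map hI.aemeasurable (expNegSum c).continuous.aestronglyMeasurable,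
    integral_map hI.aemeasurable (expNegSum c).continuous.aestronglyMeasurable]
  simpa only [expNegSum_apply, evalSum_id_restrict] using h _ _ _

theorem integral_exp_neg_evalSum_conv (x : ι → E) (α : ι → ℝ≥0) (μ ν : Measure (E → ℝ≥0))
    [SFinite μ] [SFinite ν] :
    ∫ y, Real.exp (-(evalSum x α y : ℝ)) ∂(μ.conv ν) =
      (∫ y, Real.exp (-(evalSum x α y : ℝ)) ∂μ) * ∫ y, Real.exp (-(evalSum x α y : ℝ)) ∂ν := by
  rw [Measure.conv, integral_map (by fun_prop)
    (Measurable.aestronglyMeasurable (by fun_prop)), ← integral_prod_mul]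
  simp [evalSum_add, Real.exp_add, mul_comm]

end LaplaceUniqueness

/-! ### First moments from Laplace transforms -/

section FirstMoment

variable {X Y : Type*} [MeasurableSpace X] [MeasurableSpace Y] {m : Measure X} {k : Measure Y}
  {w : X → ℝ≥0} {v : Y → ℝ≥0}

theorem one_sub_exp_neg_nonneg {r : ℝ} (hr : 0 ≤ r) : 0 ≤ 1 - Real.exp (-r) := by
  simpa using hr

theorem one_sub_exp_neg_le (r : ℝ) : 1 - Real.exp (-r) ≤ r := by
  linarith [Real.one_sub_le_exp_neg r]

theorem le_exp_mul_one_sub_exp_neg (r : ℝ) : r ≤ Real.exp r * (1 - Real.exp (-r)) := by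
  rw [mul_sub, ← Real.exp_add, mul_one, add_neg_cancel, Real.exp_zero]
  linarith [Real.add_one_le_exp r]

theorem one_sub_exp_neg_mul_div_mem_Icc {u : ℝ} (hu : 0 < u) {r : ℝ} (hr : 0 ≤ r) :
    (1 - Real.exp (-(u * r))) / u ∈ Icc 0 r :=
  ⟨div_nonneg (one_sub_exp_neg_nonneg (by positivity)) hu.le,
    (div_le_iff₀' hu).2 (one_sub_exp_neg_le _)⟩

theorem tendsto_one_sub_exp_neg_mul_div (r : ℝ) :
    Tendsto (fun u : ℝ => (1 - Real.exp (-(u * r))) / u) (𝓝[>] 0) (𝓝 r) := by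
  have hderiv : HasDerivAt (fun u : ℝ => 1 - Real.exp (-(u * r))) r 0 := by
    simpa using (((hasDerivAt_id (0 : ℝ)).mul_const r).neg.exp).const_sub 1
  have hslope :=
    (hasDerivWithinAt_iff_tendsto_slope' (by simp)).1 (hderiv.hasDerivWithinAt (s := Ioi 0))
  simpa [slope_fun_def_field] using hslope

theorem tendsto_lintegral_one_sub_exp_neg_mul_div (m : Measure X) (hw : Measurable w) :
    Tendsto (fun u : ℝ => ∫⁻ z, ENNReal.ofReal ((1 - Real.exp (-(u * w z))) / u) ∂m)
      (𝓝[>] 0) (𝓝 (∫⁻ z, w z ∂m)) := by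
  refine tendsto_of_le_liminf_of_limsup_le ?_ (limsup_le_of_le (by isBoundedDefault) ?_)
  · have hlim (z : X) : liminf (fun u : ℝ => ENNReal.ofReal ((1 - Real.exp (-(u * w z))) / u))
        (𝓝[>] 0) = w z := by
      simpa using (ENNReal.tendsto_ofReal (tendsto_one_sub_exp_neg_mul_div (w z))).liminf_eq
    simpa only [hlim] using lintegral_liminf_le (μ := m) (u := 𝓝[>] (0 : ℝ))
      (f := fun u z => ENNReal.ofReal ((1 - Real.exp (-(u * w z))) / u)) fun u => by fun_prop
  · filter_upwards [self_mem_nhdsWithin] with u hu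
    gcongr with z
    simpa using ENNReal.ofReal_le_ofReal
      (one_sub_exp_neg_mul_div_mem_Icc (mem_Ioi.1 hu) (w z).coe_nonneg).2

theorem integrable_coe_of_lintegral_lt_top (hw : Measurable w) (h : ∫⁻ z, w z ∂m < ∞) :
    Integrable (fun z => (w z : ℝ)) m :=
  ⟨by fun_prop, by simpa [HasFiniteIntegral] using h⟩

theorem one_sub_exp_neg_le_min (r : ℝ≥0) : 1 - Real.exp (-(r : ℝ)) ≤ (min r 1 : ℝ≥0) := by
  rw [NNReal.coe_min]
  exact le_min (one_sub_exp_neg_le r) (by simpa using (Real.exp_pos _).le)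

theorem integrable_one_sub_exp_neg_of_lintegral_min_lt_top (hw : Measurable w)
    (h : ∫⁻ z, (min (w z) 1 : ℝ≥0) ∂m < ∞) :
    Integrable (fun z => 1 - Real.exp (-(w z : ℝ))) m := by
  refine (integrable_coe_of_lintegral_lt_top (hw.min measurable_const) h).mono' (by fun_prop)
    (ae_of_all _ fun z => ?_)
  rw [Real.norm_of_nonneg (one_sub_exp_neg_nonneg (w z).coe_nonneg)]
  exact one_sub_exp_neg_le_min (w z)

theorem integrable_one_sub_exp_neg (hw : Measurable w) (h : ∫⁻ z, w z ∂m < ∞) :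
    Integrable (fun z => 1 - Real.exp (-(w z : ℝ))) m :=
  integrable_one_sub_exp_neg_of_lintegral_min_lt_top hw <|
    (lintegral_mono fun z => by gcongr; exact min_le_left _ _).trans_lt h

theorem lintegral_min_const_mul_lt_top (hw : Measurable w) (h : ∫⁻ z, (min (w z) 1 : ℝ≥0) ∂m < ∞)
    (u : ℝ≥0) : ∫⁻ z, (min (u * w z) 1 : ℝ≥0) ∂m < ∞ := by
  have hle (z : X) : min (u * w z) 1 ≤ (u + 1) * min (w z) 1 := by
    rcases le_total (w z) 1 with h | h
    · rw [min_eq_left h]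
      exact (min_le_left _ _).trans (by gcongr; exact le_self_add)
    · rw [min_eq_right h]
      exact (min_le_right _ _).trans (by simp)
  calc ∫⁻ z, (min (u * w z) 1 : ℝ≥0) ∂m
      ≤ ∫⁻ z, (u + 1 : ℝ≥0) * (min (w z) 1 : ℝ≥0) ∂m :=
        lintegral_mono fun z => by rw [← ENNReal.coe_mul]; exact ENNReal.coe_le_coe.2 (hle z)
    _ = (u + 1 : ℝ≥0) * ∫⁻ z, (min (w z) 1 : ℝ≥0) ∂m := lintegral_const_mul _ (by fun_prop)
    _ < ∞ := ENNReal.mul_lt_top ENNReal.coe_lt_top h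

theorem tendsto_integral_exp_neg_mul [IsFiniteMeasure m] (hw : Measurable w) :
    Tendsto (fun u : ℝ => ∫ z, Real.exp (-(u * w z)) ∂m) (𝓝[>] 0) (𝓝 (m.real univ)) := by
  have hlim : Tendsto (fun u : ℝ => ∫ z, Real.exp (-(u * w z)) ∂m) (𝓝[>] 0)
      (𝓝 (∫ _, (1 : ℝ) ∂m)) := by
    refine tendsto_integral_filter_of_dominated_convergence (fun _ => 1)
      (.of_forall fun u => by fun_prop) ?_ (integrable_const 1) (ae_of_all _ fun z => ?_)
    · filter_upwards [self_mem_nhdsWithin] with u hu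
      exact ae_of_all _ fun z => by simpa using mul_nonneg (mem_Ioi.1 hu).le (w z).coe_nonneg
    · have hcont : Continuous fun u : ℝ => Real.exp (-(u * w z)) := by fun_prop
      simpa using (hcont.tendsto 0).mono_left nhdsWithin_le_nhds
  simpa using hlim

theorem tendsto_ofReal_integral_one_sub_exp_neg_mul_div (hw : Measurable w)
    (hint : ∀ u : ℝ≥0, Integrable (fun z => 1 - Real.exp (-((u : ℝ) * w z))) m) :
    Tendsto (fun u : ℝ => ENNReal.ofReal ((∫ z, (1 - Real.exp (-(u * w z))) ∂m) / u)) (𝓝[>] 0)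
      (𝓝 (∫⁻ z, w z ∂m)) := by
  refine (tendsto_lintegral_one_sub_exp_neg_mul_div m hw).congr' ?_
  filter_upwards [self_mem_nhdsWithin] with u hu
  lift u to ℝ≥0 using (mem_Ioi.1 hu).le
  rw [← integral_div, ofReal_integral_eq_lintegral_ofReal ((hint u).div_const u)]
  exact ae_of_all _ fun z =>
    (one_sub_exp_neg_mul_div_mem_Icc (mem_Ioi.1 hu) (w z).coe_nonneg).1

/-- This is the comparison of right derivatives at `u = 0`; the inequalities
`A e⁻ᴬ ≤ 1 - e⁻ᴬ ≤ A` make it work without any integrability of `w` or `v`. -/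
theorem lintegral_eq_mul_lintegral_of_laplace_eq [IsFiniteMeasure m] (hw : Measurable w)
    (hv : Measurable v)
    (hint : ∀ u : ℝ≥0, Integrable (fun y => 1 - Real.exp (-((u : ℝ) * v y))) k)
    (h : ∀ u : ℝ≥0, ∫ z, Real.exp (-((u : ℝ) * w z)) ∂m =
      m.real univ * Real.exp (-∫ y, (1 - Real.exp (-((u : ℝ) * v y))) ∂k)) :
    ∫⁻ z, w z ∂m = m univ * ∫⁻ y, v y ∂k := by
  rcases eq_zero_or_neZero m with rfl | hm
  · simp
  have hM : 0 < m.real univ := measureReal_univ_pos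
  set A : ℝ → ℝ := fun u => ∫ y, (1 - Real.exp (-(u * v y))) ∂k
  have hexpw (u : ℝ≥0) : Integrable (fun z => Real.exp (-((u : ℝ) * w z))) m := by
    simpa using integrable_exp_neg (m := m) (hw.const_mul u)
  have hlimw := tendsto_ofReal_integral_one_sub_exp_neg_mul_div hw
    fun u => (integrable_const 1).sub (hexpw u)
  have hlimv := ENNReal.Tendsto.const_mul (a := m univ)
    (tendsto_ofReal_integral_one_sub_exp_neg_mul_div hv hint) (.inr (measure_ne_top m univ))
  have hlaplace : ∀ᶠ u in 𝓝[>] (0 : ℝ), 0 < u ∧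
      ∫ z, Real.exp (-(u * w z)) ∂m = m.real univ * Real.exp (-A u) ∧
      ∫ z, (1 - Real.exp (-(u * w z))) ∂m = m.real univ * (1 - Real.exp (-A u)) := by
    filter_upwards [self_mem_nhdsWithin] with u hu
    lift u to ℝ≥0 using (mem_Ioi.1 hu).le
    refine ⟨hu, h u, ?_⟩
    rw [integral_sub (integrable_const 1) (hexpw u), h u, mul_sub]
    simp [A]
  have hexp : Tendsto (fun u => ENNReal.ofReal (Real.exp (A u))) (𝓝[>] 0) (𝓝 1) := by
    have hlim := ((tendsto_integral_exp_neg_mul (m := m) hw).inv₀ hM.ne').const_mul (m.real univ)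
    rw [mul_inv_cancel₀ hM.ne'] at hlim
    refine ENNReal.ofReal_one ▸ ENNReal.tendsto_ofReal (hlim.congr' ?_)
    filter_upwards [hlaplace] with u ⟨_, hu, _⟩
    rw [hu, mul_inv, mul_inv_cancel_left₀ hM.ne', Real.exp_neg, inv_inv]
  refine le_antisymm (le_of_tendsto_of_tendsto hlimw hlimv ?_) ?_
  · filter_upwards [hlaplace] with u ⟨hu, _, hwu⟩
    rw [hwu, ← ofReal_measureReal, ← ENNReal.ofReal_mul hM.le, ← mul_div_assoc]
    gcongr
    exact one_sub_exp_neg_le _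
  · have hlim := ENNReal.Tendsto.mul hexp (.inl one_ne_zero) hlimw (.inr ENNReal.one_ne_top)
    rw [one_mul] at hlim
    refine le_of_tendsto_of_tendsto hlimv hlim ?_
    filter_upwards [hlaplace] with u ⟨hu, _, hwu⟩
    rw [hwu, ← ofReal_measureReal, ← ENNReal.ofReal_mul hM.le,
      ← ENNReal.ofReal_mul (Real.exp_nonneg _), ← mul_div_assoc, ← mul_div_assoc, mul_left_comm]
    gcongr
    exact le_exp_mul_one_sub_exp_neg _

theorem tendsto_integral_one_sub_exp_neg_mul_div_atTop (hw : Measurable w)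
    (h : ∫⁻ z, (min (w z) 1 : ℝ≥0) ∂m < ∞) :
    Tendsto (fun u : ℝ => ∫ z, (1 - Real.exp (-(u * w z))) / u ∂m) atTop (𝓝 0) := by
  have hle_inv {u : ℝ} (hu : 0 < u) (z : X) : (1 - Real.exp (-(u * w z))) / u ≤ u⁻¹ := by
    rw [← one_div]
    gcongr
    simpa using (Real.exp_pos _).le
  have hbound : ∀ᶠ u : ℝ in atTop, ∀ᵐ z ∂m,
      ‖(1 - Real.exp (-(u * w z))) / u‖ ≤ (min (w z) 1 : ℝ≥0) := by
    filter_upwards [eventually_ge_atTop 1] with u hu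
    refine ae_of_all _ fun z => ?_
    have hu0 : 0 < u := one_pos.trans_le hu
    obtain ⟨hnonneg, hle⟩ := one_sub_exp_neg_mul_div_mem_Icc hu0 (w z).coe_nonneg
    rw [Real.norm_of_nonneg hnonneg, NNReal.coe_min]
    exact le_min hle ((hle_inv hu0 z).trans (inv_le_one_of_one_le₀ hu))
  have hlim (z : X) : Tendsto (fun u : ℝ => (1 - Real.exp (-(u * w z))) / u) atTop (𝓝 0) := by
    refine squeeze_zero' ?_ ?_ tendsto_inv_atTop_zero <;>
      filter_upwards [eventually_gt_atTop 0] with u hu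
    · exact (one_sub_exp_neg_mul_div_mem_Icc hu (w z).coe_nonneg).1
    · exact hle_inv hu z
  simpa using tendsto_integral_filter_of_dominated_convergence
    (fun z => ((min (w z) 1 : ℝ≥0) : ℝ)) (.of_forall fun u => by fun_prop) hbound
    (integrable_coe_of_lintegral_lt_top (hw.min measurable_const) h) (ae_of_all _ hlim)

end FirstMoment

/-! ### Lévy–Khintchine representations and Palm's formula -/

/-- The Lévy–Khintchine representation of the law `μ` of a driftless nonnegative infinitely
divisible process. Compared with `IsProcessLevyMeasure`, the mass of `ν` at the zero path is left
undetermined. -/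
structure HasLevyLaplace {E : Type*} (ν μ : Measure (E → ℝ≥0)) : Prop where
  lintegral_min_eval_lt_top : ∀ x, ∫⁻ y, (min (y x) 1 : ℝ≥0) ∂ν < ∞
  laplace : ∀ (n : ℕ) (x : Fin n → E) (α : Fin n → ℝ≥0),
    ∫ y, Real.exp (-(evalSum x α y : ℝ)) ∂μ =
      Real.exp (-∫ y, (1 - Real.exp (-(evalSum x α y : ℝ))) ∂ν)

theorem measurableSet_eval_le {E : Type*} (a : E) (ε : ℝ≥0) :
    MeasurableSet {y : E → ℝ≥0 | y a ≤ ε} :=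
  measurableSet_le (measurable_pi_apply a) measurable_const

namespace HasLevyLaplace

variable {E : Type*} {ν μ R R' : Measure (E → ℝ≥0)}

theorem lintegral_min_evalSum_lt_top (h : HasLevyLaplace ν μ) {n : ℕ} (x : Fin n → E)
    (α : Fin n → ℝ≥0) : ∫⁻ y, (min (evalSum x α y) 1 : ℝ≥0) ∂ν < ∞ := by
  have hle (y : E → ℝ≥0) : min (evalSum x α y) 1 ≤ ∑ i, min (α i * y (x i)) 1 :=
    Finset.le_sum_of_subadditive (fun r => min r 1) (by simp) (fun r s => by
      rcases le_total r 1 with hr | hr <;> rcases le_total s 1 with hs | hs <;>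
        simp [hr, hs]) _ _
  calc ∫⁻ y, (min (evalSum x α y) 1 : ℝ≥0) ∂ν
      ≤ ∫⁻ y, ∑ i, ((min (α i * y (x i)) 1 : ℝ≥0) : ℝ≥0∞) ∂ν :=
        lintegral_mono fun y => by
          rw [← ENNReal.ofNNReal_finsetSum]
          exact ENNReal.coe_le_coe.2 (hle y)
    _ = ∑ i, ∫⁻ y, (min (α i * y (x i)) 1 : ℝ≥0) ∂ν :=
        lintegral_finsetSum _ fun i _ => by fun_prop
    _ < ∞ := ENNReal.sum_lt_top.2 fun i _ =>
        lintegral_min_const_mul_lt_top (by fun_prop) (h.lintegral_min_eval_lt_top _) (α i)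

theorem integrable_one_sub_exp_neg_evalSum (h : HasLevyLaplace ν μ) {n : ℕ} (x : Fin n → E)
    (α : Fin n → ℝ≥0) : Integrable (fun y => 1 - Real.exp (-(evalSum x α y : ℝ))) ν :=
  integrable_one_sub_exp_neg_of_lintegral_min_lt_top (measurable_evalSum x α)
    (h.lintegral_min_evalSum_lt_top x α)

theorem isProbabilityMeasure (h : HasLevyLaplace ν μ) : IsProbabilityMeasure μ := by
  refine ⟨?_⟩
  have hreal : μ.real univ = 1 := by
    simpa [evalSum] using h.laplace 0 Fin.elim0 Fin.elim0
  rwa [measureReal_def, ENNReal.toReal_eq_one_iff] at hreal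

theorem laplace_eval (h : HasLevyLaplace ν μ) (x : E) (u : ℝ≥0) :
    ∫ y, Real.exp (-((u : ℝ) * y x)) ∂μ =
      Real.exp (-∫ y, (1 - Real.exp (-((u : ℝ) * y x))) ∂ν) := by
  simpa [evalSum] using h.laplace 1 (fun _ => x) (fun _ => u)

theorem integrable_exp_neg_evalSum_mul_one_sub_exp_neg (h : HasLevyLaplace ν μ) {n : ℕ}
    (t : Fin n → E) (α : Fin n → ℝ≥0) (x : E) (u : ℝ≥0) :
    Integrable
      (fun y => Real.exp (-(evalSum t α y : ℝ)) * (1 - Real.exp (-((u : ℝ) * y x)))) ν := by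
  have hx := h.integrable_one_sub_exp_neg_evalSum (fun _ : Fin 1 => x) (fun _ => u)
  simp only [evalSum, Finset.sum_const, Finset.card_univ, Fintype.card_fin, one_smul,
    NNReal.coe_mul] at hx
  exact hx.bdd_mul (c := 1) (by fun_prop) (ae_of_all _ fun y => by simp)

theorem integral_exp_neg_evalSum_mul_exp_neg (h : HasLevyLaplace ν μ) {n : ℕ}
    (t : Fin n → E) (α : Fin n → ℝ≥0) (x : E) (u : ℝ≥0) :
    ∫ z, Real.exp (-(evalSum t α z : ℝ)) * Real.exp (-((u : ℝ) * z x)) ∂μ =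
      (∫ z, Real.exp (-(evalSum t α z : ℝ)) ∂μ) *
        Real.exp
          (-∫ y, Real.exp (-(evalSum t α y : ℝ)) * (1 - Real.exp (-((u : ℝ) * y x))) ∂ν) := by
  have hlaplace := h.laplace (n + 1) (Fin.cons x t) (Fin.cons u α)
  simp only [evalSum_cons, NNReal.coe_add, NNReal.coe_mul, neg_add_rev, Real.exp_add] at hlaplace
  rw [hlaplace, h.laplace, ← Real.exp_add, ← neg_add,
    ← integral_add (h.integrable_one_sub_exp_neg_evalSum t α)
      (h.integrable_exp_neg_evalSum_mul_one_sub_exp_neg t α x u)]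
  congr 2
  exact integral_congr_ae (ae_of_all _ fun y => by ring)

/-- The density `G = exp (-⟨α, z⟩)` tilts `μ` into a multiple of an infinitely divisible law with
Lévy measure `G ν`, whose mean at `x` is the first moment of `G ν`. -/
theorem lintegral_eval_mul_exp_neg_evalSum (h : HasLevyLaplace ν μ) (x : E) {n : ℕ}
    (t : Fin n → E) (α : Fin n → ℝ≥0) :
    ∫⁻ z, z x * ENNReal.ofReal (Real.exp (-(evalSum t α z : ℝ))) ∂μ =
      (∫⁻ z, ENNReal.ofReal (Real.exp (-(evalSum t α z : ℝ))) ∂μ) *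
        ∫⁻ y, y x * ENNReal.ofReal (Real.exp (-(evalSum t α y : ℝ))) ∂ν := by
  have := h.isProbabilityMeasure
  set G : (E → ℝ≥0) → ℝ≥0 := fun z => (Real.exp (-(evalSum t α z : ℝ))).toNNReal
  have hG : Measurable G := by fun_prop
  have hGcoe (z : E → ℝ≥0) : (G z : ℝ) = Real.exp (-(evalSum t α z : ℝ)) :=
    Real.coe_toNNReal _ (Real.exp_nonneg _)
  have hx : Measurable fun z : E → ℝ≥0 => z x := measurable_pi_apply x
  have hfin : IsFiniteMeasure (μ.withDensity fun z => (G z : ℝ≥0∞)) := by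
    refine isFiniteMeasure_withDensity (ne_of_lt ?_)
    calc ∫⁻ z, G z ∂μ ≤ ∫⁻ _, 1 ∂μ := lintegral_mono fun z => by simp [G]
      _ < ∞ := by simp
  have hmean := lintegral_eq_mul_lintegral_of_laplace_eq (m := μ.withDensity fun z => (G z : ℝ≥0∞))
    (k := ν.withDensity fun y => (G y : ℝ≥0∞)) hx hx (fun u => ?_) fun u => ?_
  · rw [lintegral_withDensity_eq_lintegral_mul _ (by fun_prop) (by fun_prop),
      lintegral_withDensity_eq_lintegral_mul _ (by fun_prop) (by fun_prop)] at hmean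
    simpa [G, mul_comm, ENNReal.ofReal] using hmean
  · rw [integrable_withDensity_iff_integrable_smul hG]
    simpa only [NNReal.smul_def, smul_eq_mul, hGcoe] using
      h.integrable_exp_neg_evalSum_mul_one_sub_exp_neg t α x u
  · have hmass : (μ.withDensity fun z => (G z : ℝ≥0∞)).real univ = ∫ z, (G z : ℝ) ∂μ := by
      simpa [NNReal.smul_def] using
        integral_withDensity_eq_integral_smul hG (μ := μ) fun _ => (1 : ℝ)
    simp only [hmass, integral_withDensity_eq_integral_smul hG, NNReal.smul_def, smul_eq_mul, hGcoe]
    exact h.integral_exp_neg_evalSum_mul_exp_neg t α x u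

/-- Palm's formula; it differentiates the Laplace transform of `μ` in the variable attached
to `x`. -/
theorem withDensity_eval (h : HasLevyLaplace ν μ) {x : E} (hx : ∫⁻ y, y x ∂ν ≠ ∞) :
    μ.withDensity (fun z => (z x : ℝ≥0∞)) = μ.conv (ν.withDensity fun y => (y x : ℝ≥0∞)) := by
  have := h.isProbabilityMeasure
  have := isFiniteMeasure_withDensity hx
  have hmean : ∫⁻ z, z x ∂μ = ∫⁻ y, y x ∂ν := by
    simpa [evalSum] using h.lintegral_eval_mul_exp_neg_evalSum x Fin.elim0 Fin.elim0
  have : IsFiniteMeasure (μ.withDensity fun z => (z x : ℝ≥0∞)) :=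
    isFiniteMeasure_withDensity (hmean ▸ hx)
  refine ext_of_laplace fun n t α => ?_
  have htoReal (m : Measure (E → ℝ≥0)) : ∫ y, Real.exp (-(evalSum t α y : ℝ)) ∂m =
      (∫⁻ y, ENNReal.ofReal (Real.exp (-(evalSum t α y : ℝ))) ∂m).toReal :=
    integral_eq_lintegral_of_nonneg_ae (ae_of_all _ fun _ => Real.exp_nonneg _)
      (Measurable.aestronglyMeasurable (by fun_prop))
  rw [integral_exp_neg_evalSum_conv, htoReal, htoReal, htoReal, ← ENNReal.toReal_mul,
    lintegral_withDensity_eq_lintegral_mul _ (by fun_prop) (by fun_prop),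
    lintegral_withDensity_eq_lintegral_mul _ (by fun_prop) (by fun_prop)]
  exact congrArg _ (h.lintegral_eval_mul_exp_neg_evalSum x t α)

theorem setLIntegral_eval_le (h : HasLevyLaplace ν μ) {x : E} (hx : ∫⁻ y, y x ∂ν ≠ ∞) (a : E)
    (ε : ℝ≥0) :
    ∫⁻ z in {z | z a ≤ ε}, z x ∂μ ≤ μ {z | z a ≤ ε} * ∫⁻ y in {y | y a ≤ ε}, y x ∂ν := by
  have := isFiniteMeasure_withDensity hx
  have hS := measurableSet_eval_le a ε
  have hsub : (fun p : (E → ℝ≥0) × (E → ℝ≥0) => p.1 + p.2) ⁻¹' {z | z a ≤ ε} ⊆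
      {z | z a ≤ ε} ×ˢ {y | y a ≤ ε} := fun p hp =>
    ⟨(le_self_add : p.1 a ≤ p.1 a + p.2 a).trans hp, (le_add_self : p.2 a ≤ p.1 a + p.2 a).trans hp⟩
  rw [← withDensity_apply _ hS, ← withDensity_apply _ hS, h.withDensity_eval hx, Measure.conv,
    Measure.map_apply measurable_add hS, ← Measure.prod_prod]
  exact measure_mono hsub

theorem measure_eval_le_ne_zero (h : HasLevyLaplace ν μ) (a : E) {ε : ℝ≥0} (hε : 0 < ε) :
    μ {z | z a ≤ ε} ≠ 0 := by
  have := h.isProbabilityMeasure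
  intro hzero
  have hlow : ∀ᵐ z ∂μ, ε < z a := by simpa [ae_iff] using hzero
  have hbound (u : ℝ) (hu : 0 < u) :
      (ε : ℝ) ≤ ∫ y, (1 - Real.exp (-(u * y a))) / u ∂ν := by
    lift u to ℝ≥0 using hu.le
    have hexp : ∫ z, Real.exp (-((u : ℝ) * z a)) ∂μ ≤ ∫ _, Real.exp (-((u : ℝ) * ε)) ∂μ := by
      refine integral_mono_ae ?_ (integrable_const _) ?_
      · simpa using integrable_exp_neg (m := μ) ((measurable_pi_apply a).const_mul u)
      · filter_upwards [hlow] with z hz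
        gcongr
    rw [h.laplace_eval, integral_const, probReal_univ, one_smul, Real.exp_le_exp,
      neg_le_neg_iff] at hexp
    rwa [integral_div, le_div_iff₀' hu]
  have hε0 : (ε : ℝ) ≤ 0 := ge_of_tendsto
    (tendsto_integral_one_sub_exp_neg_mul_div_atTop (measurable_pi_apply a)
      (h.lintegral_min_eval_lt_top a)) ((eventually_gt_atTop 0).mono hbound)
  exact hε.not_ge (by exact_mod_cast hε0)

theorem conv_left_cancel (h : HasLevyLaplace ν μ) [IsFiniteMeasure R] [IsFiniteMeasure R']
    (hR : μ.conv R = μ.conv R') : R = R' := by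
  have := h.isProbabilityMeasure
  refine ext_of_laplace fun n x α => ?_
  have heq := congrArg (fun m => ∫ y, Real.exp (-(evalSum x α y : ℝ)) ∂m) hR
  simp only [integral_exp_neg_evalSum_conv, h.laplace] at heq
  exact mul_left_cancel₀ (Real.exp_ne_zero _) heq

end HasLevyLaplace

/-! ### Conditioning on a vanishing coordinate -/

section Conditioning

variable {E : Type*} {μ Q Q' R ν : Measure (E → ℝ≥0)} {a : E}

theorem eq_dirac_zero_of_lintegral_eval_eq_zero [IsProbabilityMeasure μ]
    (h : ∀ x, ∫⁻ z, z x ∂μ = 0) : μ = Measure.dirac 0 := by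
  refine ext_of_laplace fun n x α => ?_
  have hzero (i : Fin n) : ∀ᵐ z ∂μ, z (x i) = 0 := by
    simpa [lintegral_eq_zero_iff (show Measurable fun z : E → ℝ≥0 => (z (x i) : ℝ≥0∞) by fun_prop),
      EventuallyEq] using h (x i)
  have hone : (fun z => Real.exp (-(evalSum x α z : ℝ))) =ᵐ[μ] fun _ => 1 := by
    filter_upwards [ae_all_iff.2 hzero] with z hz
    simp [evalSum, hz]
  rw [integral_congr_ae hone, integral_dirac' _ _ (Measurable.stronglyMeasurable (by fun_prop))]
  simp [evalSum]

theorem restrict_conv_eq [SFinite Q] [SFinite R] (hQ : ∀ᵐ y ∂Q, y a = 0) (ε : ℝ≥0) :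
    (Q.conv R).restrict {y | y a ≤ ε} = Q.conv (R.restrict {y | y a ≤ ε}) := by
  have hprod : Q.prod (R.restrict {y | y a ≤ ε}) =
      (Q.prod R).restrict (univ ×ˢ {y | y a ≤ ε}) := by
    rw [← Measure.prod_restrict, Measure.restrict_univ]
  rw [Measure.conv, Measure.restrict_map measurable_add (measurableSet_eval_le a ε), Measure.conv,
    hprod]
  congr 1
  refine Measure.restrict_congr_set ?_
  filter_upwards [Measure.quasiMeasurePreserving_fst.ae hQ] with p hp
  refine propext ?_
  change p.1 a + p.2 a ≤ ε ↔ p.1 ∈ univ ∧ p.2 a ≤ ε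
  simp [hp]

theorem measure_conv_eval_le [IsProbabilityMeasure Q] [SFinite R] (hQ : ∀ᵐ y ∂Q, y a = 0)
    (ε : ℝ≥0) : (Q.conv R) {y | y a ≤ ε} = R {y | y a ≤ ε} := by
  rw [← Measure.restrict_apply_univ, restrict_conv_eq hQ, Measure.conv,
    Measure.map_apply measurable_add MeasurableSet.univ, preimage_univ, ← univ_prod_univ,
    Measure.prod_prod]
  simp

theorem cond_conv_eq [IsProbabilityMeasure Q] [SFinite R] (hQ : ∀ᵐ y ∂Q, y a = 0) (ε : ℝ≥0) :
    (Q.conv R)[|{y | y a ≤ ε}] = Q.conv R[|{y | y a ≤ ε}] := by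
  rw [ProbabilityTheory.cond, ProbabilityTheory.cond, measure_conv_eval_le hQ,
    restrict_conv_eq hQ, Measure.conv_smul_right]

theorem exists_forall_nndist_le_add_mul_sum {ι : Type*} [Fintype ι]
    (g : BoundedContinuousFunction (ι → ℝ≥0) ℝ) {η : ℝ≥0} (hη : 0 < η) :
    ∃ C : ℝ≥0, ∀ z, nndist (g z) (g 0) ≤ η + C * ∑ i, z i := by
  obtain ⟨δ, hδ, hclose⟩ := Metric.continuousAt_iff.1 g.continuous.continuousAt η (by simpa)
  lift δ to ℝ≥0 using hδ.le
  replace hδ : 0 < δ := hδ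
  refine ⟨2 * ‖g‖₊ / δ, fun z => ?_⟩
  by_cases hz : dist z 0 < δ
  · exact (show nndist (g z) (g 0) ≤ η from (hclose hz).le).trans le_self_add
  · obtain ⟨i, hi⟩ : ∃ i, δ ≤ z i := by
      simpa [dist_pi_lt_iff (show (0 : ℝ) < δ from hδ), NNReal.dist_eq] using hz
    calc nndist (g z) (g 0) ≤ 2 * ‖g‖₊ := g.dist_le_two_norm _ _
      _ = 2 * ‖g‖₊ / δ * δ := by field_simp
      _ ≤ 2 * ‖g‖₊ / δ * ∑ i, z i := by
          gcongr
          exact hi.trans (Finset.single_le_sum (fun _ _ => zero_le) (Finset.mem_univ i))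
      _ ≤ _ := le_add_self

theorem tendsto_integral_of_tendsto_lintegral_eval {T : Type*} {l : Filter T}
    {m : T → Measure (E → ℝ≥0)} (hm : ∀ᶠ ε in l, IsProbabilityMeasure (m ε))
    (h : ∀ x, Tendsto (fun ε => ∫⁻ z, z x ∂(m ε)) l (𝓝 0)) (I : Finset E)
    (g : BoundedContinuousFunction (I → ℝ≥0) ℝ) :
    Tendsto (fun ε => ∫ z, g (I.restrict z) ∂(m ε)) l (𝓝 (g 0)) := by
  have hg : Measurable fun z : E → ℝ≥0 => g (I.restrict z) :=
    g.continuous.measurable.comp (Finset.measurable_restrict I)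
  rw [tendsto_iff_edist_tendsto_0, ENNReal.tendsto_nhds_zero]
  intro r hr
  obtain ⟨η, hη, hηr⟩ := ENNReal.lt_iff_exists_nnreal_btwn.1 hr
  obtain ⟨C, hC⟩ := exists_forall_nndist_le_add_mul_sum g (ENNReal.coe_pos.1 hη)
  have hlim : Tendsto (fun ε => η + C * ∑ x : I, ∫⁻ z, z x ∂(m ε)) l (𝓝 (η : ℝ≥0∞)) := by
    have hsum : Tendsto (fun ε => ∑ x : I, ∫⁻ z, z x ∂(m ε)) l (𝓝 0) := by
      simpa using tendsto_finsetSum Finset.univ fun (x : I) _ => h x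
    simpa using (ENNReal.Tendsto.const_mul hsum (.inr ENNReal.coe_ne_top)).const_add (η : ℝ≥0∞)
  filter_upwards [hm, hlim.eventually_le_const hηr] with ε hε hle
  refine le_trans ?_ hle
  calc edist (∫ z, g (I.restrict z) ∂(m ε)) (g 0)
      = ‖∫ z, (g (I.restrict z) - g 0) ∂(m ε)‖ₑ := by
        rw [integral_sub (.of_bound hg.aestronglyMeasurable ‖g‖
          (ae_of_all _ fun z => g.norm_coe_le_norm _)) (integrable_const _), edist_eq_enorm_sub]
        simp
    _ ≤ ∫⁻ z, ‖g (I.restrict z) - g 0‖ₑ ∂(m ε) := enorm_integral_le_lintegral_enorm _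
    _ ≤ ∫⁻ z, (η + C * ∑ x : I, (z x : ℝ≥0∞)) ∂(m ε) := lintegral_mono fun z => by
        rw [← edist_eq_enorm_sub, edist_nndist]
        simpa using ENNReal.coe_le_coe.2 (hC (I.restrict z))
    _ = η + C * ∑ x : I, ∫⁻ z, z x ∂(m ε) := by
        rw [lintegral_add_left measurable_const, lintegral_const_mul _ (by fun_prop),
          lintegral_finsetSum _ fun x _ => by fun_prop]
        simp

/-- Averaging `g (y + ·)` over `Q`, so that the limit of `∫ g ∂(Q ∗ R)` as `R` concentrates at `0`
is read off from `R` alone. -/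
noncomputable def convTest (Q : Measure (E → ℝ≥0)) [IsProbabilityMeasure Q] {I : Finset E}
    (g : BoundedContinuousFunction (I → ℝ≥0) ℝ) : BoundedContinuousFunction (I → ℝ≥0) ℝ :=
  BoundedContinuousFunction.ofNormedAddCommGroup (fun z => ∫ y, g (I.restrict y + z) ∂Q)
    (continuous_of_dominated (bound := fun _ => ‖g‖)
      (fun z => (g.continuous.measurable.comp
        (Measurable.add_const (by fun_prop) z)).aestronglyMeasurable)
      (fun _ => ae_of_all _ fun _ => g.norm_coe_le_norm _) (integrable_const _)
      (ae_of_all _ fun _ => by fun_prop))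
    ‖g‖ fun z => by
      simpa using norm_integral_le_of_norm_le_const (μ := Q) (f := fun y => g (I.restrict y + z))
        (ae_of_all _ fun y => g.norm_coe_le_norm _)

theorem integral_conv_eq_integral_convTest [IsProbabilityMeasure Q] [IsFiniteMeasure R]
    {I : Finset E} (g : BoundedContinuousFunction (I → ℝ≥0) ℝ) :
    ∫ y, g (I.restrict y) ∂(Q.conv R) =
      ∫ z, convTest Q g (I.restrict z) ∂(R) := by
  have hg : Measurable fun y : E → ℝ≥0 => g (I.restrict y) :=
    g.continuous.measurable.comp (Finset.measurable_restrict I)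
  rw [Measure.conv, integral_map measurable_add.aemeasurable hg.aestronglyMeasurable,
    integral_prod_symm]
  · rfl
  · exact .of_bound (hg.comp measurable_add).aestronglyMeasurable ‖g‖
      (ae_of_all _ fun _ => g.norm_coe_le_norm _)

theorem tendsto_integral_conv {T : Type*} {l : Filter T} {m : T → Measure (E → ℝ≥0)}
    [IsProbabilityMeasure Q] (hm : ∀ᶠ ε in l, IsProbabilityMeasure (m ε))
    (h : ∀ x, Tendsto (fun ε => ∫⁻ z, z x ∂(m ε)) l (𝓝 0)) (I : Finset E)
    (g : BoundedContinuousFunction (I → ℝ≥0) ℝ) :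
    Tendsto (fun ε => ∫ y, g (I.restrict y) ∂(Q.conv (m ε))) l
      (𝓝 (∫ y, g (I.restrict y) ∂Q)) := by
  have hzero : convTest Q g 0 = ∫ y, g (I.restrict y) ∂Q :=
    integral_congr_ae (ae_of_all _ fun y => by simp)
  refine (hzero ▸ tendsto_integral_of_tendsto_lintegral_eval hm h I (convTest Q g)).congr' ?_
  filter_upwards [hm] with ε hε
  exact (integral_conv_eq_integral_convTest g).symm

theorem tendsto_setLIntegral_eval_le {f : (E → ℝ≥0) → ℝ≥0∞} (hf : ∫⁻ y, f y ∂ν ≠ ∞)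
    (hν : ∫⁻ y in {y | y a = 0}, f y ∂ν = 0) :
    Tendsto (fun ε : ℝ≥0 => ∫⁻ y in {y | y a ≤ ε}, f y ∂ν) (𝓝[>] 0) (𝓝 0) := by
  have hlim := tendsto_measure_biInter_gt (μ := ν.withDensity f)
    (s := fun ε : ℝ≥0 => {y : E → ℝ≥0 | y a ≤ ε}) (a := 0)
    (fun ε _ => (measurableSet_eval_le a ε).nullMeasurableSet)
    (fun i j _ hij y hy => le_trans hy hij)
    ⟨1, one_pos, by
      rw [withDensity_apply _ (measurableSet_eval_le a 1)]
      exact ne_top_of_le_ne_top hf (setLIntegral_le_lintegral _ _)⟩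
  have hInter : ⋂ r : ℝ≥0, ⋂ (_ : r > 0), {y : E → ℝ≥0 | y a ≤ r} = {y | y a ≤ 0} := by
    ext y
    simp only [mem_iInter, mem_ofPred_eq]
    exact ⟨le_of_forall_gt_imp_ge_of_dense, fun hy r hr => hy.trans hr.le⟩
  rw [hInter, withDensity_apply _ (measurableSet_eval_le a 0)] at hlim
  simp only [nonpos_iff_eq_zero, hν] at hlim
  exact hlim.congr fun ε => withDensity_apply _ (measurableSet_eval_le a ε)

namespace HasLevyLaplace

theorem lintegral_eval_cond_le (h : HasLevyLaplace ν R) {x : E} (hx : ∫⁻ y, y x ∂ν ≠ ∞) {ε : ℝ≥0}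
    (hε : R {z | z a ≤ ε} ≠ 0) :
    ∫⁻ z, z x ∂(R[|{y | y a ≤ ε}]) ≤ ∫⁻ y in {y | y a ≤ ε}, y x ∂ν := by
  have := h.isProbabilityMeasure
  rw [ProbabilityTheory.cond, lintegral_smul_measure, smul_eq_mul]
  calc _ ≤ (R {z | z a ≤ ε})⁻¹ * (R {z | z a ≤ ε} * ∫⁻ y in {y | y a ≤ ε}, y x ∂ν) := by
        gcongr
        exact h.setLIntegral_eval_le hx a ε
    _ = _ := ENNReal.inv_mul_cancel_left hε (measure_ne_top _ _)

/-- By Palm's formula the mean of `R` given `y a ≤ ε` is at most the first moment of `ν` on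
`{y a ≤ ε}`, so `R` given `y a ≤ ε` concentrates at the zero path as `ε ↓ 0`. -/
theorem isCondLawAtZero_conv [IsProbabilityMeasure Q] (hR : HasLevyLaplace ν R)
    (hfin : ∀ x, ∫⁻ y, y x ∂ν ≠ ∞) (hQ : ∀ᵐ y ∂Q, y a = 0)
    (hν : ∀ x, ∫⁻ y in {y | y a = 0}, y x ∂ν = 0) :
    IsCondLawAtZero (Q.conv R) a Q := by
  have := hR.isProbabilityMeasure
  refine ⟨fun hpos => ?_, fun ε hε => ?_, fun I g => ?_⟩
  · have hset : {y : E → ℝ≥0 | y a = 0} = {y | y a ≤ 0} := by simp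
    simp only [hset, measure_conv_eval_le hQ] at hpos hν ⊢
    have := cond_isProbabilityMeasure hpos
    have hdirac : R[|{y | y a ≤ 0}] = Measure.dirac 0 :=
      eq_dirac_zero_of_lintegral_eval_eq_zero fun x =>
        nonpos_iff_eq_zero.1 ((hR.lintegral_eval_cond_le (hfin x) hpos).trans (hν x).le)
    rw [cond_conv_eq hQ, hdirac, Measure.conv_dirac_zero]
  · rw [measure_conv_eval_le hQ]
    exact hR.measure_eval_le_ne_zero a hε
  · simp_rw [cond_conv_eq hQ]
    have hpos : ∀ᶠ ε : ℝ≥0 in 𝓝[>] 0, R {z | z a ≤ ε} ≠ 0 := by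
      filter_upwards [self_mem_nhdsWithin] with ε hε using hR.measure_eval_le_ne_zero a hε
    exact tendsto_integral_conv (hpos.mono fun ε hε => cond_isProbabilityMeasure hε)
      (fun x => tendsto_of_tendsto_of_tendsto_of_le_of_le' tendsto_const_nhds
        (tendsto_setLIntegral_eval_le (hfin x) (hν x))
        (.of_forall fun _ => zero_le)
        (hpos.mono fun ε hε => hR.lintegral_eval_cond_le (hfin x) hε)) I g

end HasLevyLaplace

theorem IsCondLawAtZero.unique [IsFiniteMeasure Q] [IsFiniteMeasure Q']
    (h : IsCondLawAtZero μ a Q) (h' : IsCondLawAtZero μ a Q') : Q = Q' := by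
  refine ext_of_map_restrict fun I => ext_of_forall_integral_eq_of_IsFiniteMeasure fun g => ?_
  have hI : Measurable (I.restrict (π := fun _ : E => ℝ≥0)) := Finset.measurable_restrict I
  rw [integral_map hI.aemeasurable g.continuous.aestronglyMeasurable,
    integral_map hI.aemeasurable g.continuous.aestronglyMeasurable]
  exact tendsto_nhds_unique (h.limit I g) (h'.limit I g)

end Conditioning

/-! ### Uniqueness of the Lévy measure of a process -/

section Uniqueness

variable {E : Type*} {ν ν' μ : Measure (E → ℝ≥0)}

theorem exists_countable_dependsOn {B : Set (E → ℝ≥0)} (hB : MeasurableSet B) :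
    ∃ J : Set E, J.Countable ∧ DependsOn (· ∈ B) J := by
  rw [← generateFrom_measurableCylinders] at hB
  induction hB with
  | basic B hB =>
    obtain ⟨I, S, -, rfl⟩ := (mem_measurableCylinders _).1 hB
    refine ⟨I, I.countable_toSet, fun y z hyz => ?_⟩
    have hrestrict : I.restrict y = I.restrict z := funext fun x => hyz x x.2
    simp [mem_cylinder, hrestrict]
  | empty => exact ⟨∅, countable_empty, fun _ _ _ => rfl⟩
  | compl B _ ih =>
    obtain ⟨J, hJ, hdep⟩ := ih
    exact ⟨J, hJ, fun y z hyz => congrArg Not (hdep hyz)⟩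
  | iUnion B _ ih =>
    choose J hJ hdep using ih
    refine ⟨⋃ n, J n, countable_iUnion hJ, fun y z hyz => ?_⟩
    have hmem (n : ℕ) : (y ∈ B n) = (z ∈ B n) :=
      hdep n fun x hx => hyz x (mem_iUnion_of_mem n hx)
    simp [hmem]

theorem measurableSet_eval_ne_zero (x : E) : MeasurableSet {y : E → ℝ≥0 | y x ≠ 0} :=
  (measurableSet_eq_fun (measurable_pi_apply x) measurable_const).compl

theorem restrict_ne_zero_eq_of_withDensity_eq {X : Type*} [MeasurableSpace X] {m m' : Measure X}
    {d : X → ℝ≥0} (hd : Measurable d)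
    (h : m.withDensity (fun y => (d y : ℝ≥0∞)) = m'.withDensity fun y => (d y : ℝ≥0∞)) :
    m.restrict {y | d y ≠ 0} = m'.restrict {y | d y ≠ 0} := by
  have hS : MeasurableSet {y | d y ≠ 0} := (measurableSet_eq_fun hd measurable_const).compl
  have hcancel (n : Measure X) : ((n.withDensity fun y => (d y : ℝ≥0∞)).restrict
      {y | d y ≠ 0}).withDensity (fun y => (d y : ℝ≥0∞)⁻¹) = n.restrict {y | d y ≠ 0} := by
    rw [restrict_withDensity hS, withDensity_inv_same (by fun_prop)]
    · filter_upwards [ae_restrict_mem hS] with y hy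
      simpa using hy
    · exact ae_of_all _ fun y => ENNReal.coe_ne_top
  rw [← hcancel m, ← hcancel m', h]

namespace HasLevyLaplace

theorem withDensity_one_sub_exp_neg_eq (h : HasLevyLaplace ν μ) (h' : HasLevyLaplace ν' μ) (x : E) :
    ν.withDensity (fun y => ((1 - Real.exp (-(y x : ℝ))).toNNReal : ℝ≥0∞)) =
      ν'.withDensity fun y => ((1 - Real.exp (-(y x : ℝ))).toNNReal : ℝ≥0∞) := by
  have := h.isProbabilityMeasure
  have hfin {n : Measure (E → ℝ≥0)} (hn : HasLevyLaplace n μ) : IsFiniteMeasure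
      (n.withDensity fun y => ((1 - Real.exp (-(y x : ℝ))).toNNReal : ℝ≥0∞)) := by
    have hint := hn.integrable_exp_neg_evalSum_mul_one_sub_exp_neg Fin.elim0 Fin.elim0 x 1
    simp only [evalSum, Finset.univ_eq_empty, Finset.sum_empty, NNReal.coe_zero, neg_zero,
      Real.exp_zero, NNReal.coe_one, one_mul] at hint
    exact isFiniteMeasure_withDensity_ofReal hint.2
  have := hfin h
  have := hfin h'
  have hd : Measurable fun y : E → ℝ≥0 => (1 - Real.exp (-(y x : ℝ))).toNNReal := by fun_prop
  have hcoe (y : E → ℝ≥0) :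
      ((1 - Real.exp (-(y x : ℝ))).toNNReal : ℝ) = 1 - Real.exp (-(y x : ℝ)) :=
    Real.coe_toNNReal _ (one_sub_exp_neg_nonneg (y x).coe_nonneg)
  refine ext_of_laplace fun n t α => ?_
  rw [integral_withDensity_eq_integral_smul hd, integral_withDensity_eq_integral_smul hd]
  have heq := (h.integral_exp_neg_evalSum_mul_exp_neg t α x 1).symm.trans
    (h'.integral_exp_neg_evalSum_mul_exp_neg t α x 1)
  have hpos : ∫ z, Real.exp (-(evalSum t α z : ℝ)) ∂μ ≠ 0 := h.laplace n t α ▸ Real.exp_ne_zero _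
  simpa [hpos, NNReal.smul_def, hcoe, mul_comm] using heq

theorem restrict_eval_ne_zero_eq (h : HasLevyLaplace ν μ) (h' : HasLevyLaplace ν' μ) (x : E) :
    ν.restrict {y | y x ≠ 0} = ν'.restrict {y | y x ≠ 0} := by
  have hset : {y : E → ℝ≥0 | y x ≠ 0} = {y | (1 - Real.exp (-(y x : ℝ))).toNNReal ≠ 0} := by
    ext y
    simp [pos_iff_ne_zero]
  rw [hset]
  exact restrict_ne_zero_eq_of_withDensity_eq (by fun_prop) (h.withDensity_one_sub_exp_neg_eq h' x)

theorem isProcessLevyMeasure (h : HasLevyLaplace ν μ) {J : Set E} (hJ : J.Countable)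
    (hν : ∀ᵐ y ∂ν, ∃ x ∈ J, y x ≠ 0) : IsProcessLevyMeasure ν μ := by
  refine ⟨h.lintegral_min_eval_lt_top, by simpa only [coe_evalSum] using h.laplace, fun A hA =>
    le_antisymm ?_ (iSup₂_le fun B _ => iSup_le fun hBA => measure_mono fun y hy => (hBA hy).1)⟩
  have hS : MeasurableSet {y : E → ℝ≥0 | ∃ x ∈ J, y x ≠ 0} := by
    have hUnion : {y : E → ℝ≥0 | ∃ x ∈ J, y x ≠ 0} = ⋃ x ∈ J, {y | y x ≠ 0} := by ext; simp
    exact hUnion ▸ MeasurableSet.biUnion hJ fun x _ => measurableSet_eval_ne_zero x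
  rw [← Measure.measure_inter_eq_of_ae hν]
  refine le_iSup₂_of_le _ (hS.inter hA) (le_iSup_of_le ?_ le_rfl)
  rintro y ⟨⟨x, -, hx⟩, hyA⟩
  exact ⟨hyA, fun hzero => hx (congrFun hzero x)⟩

end HasLevyLaplace

namespace IsProcessLevyMeasure

theorem hasLevyLaplace (h : IsProcessLevyMeasure ν μ) : HasLevyLaplace ν μ :=
  ⟨h.finite, by simpa only [coe_evalSum] using h.laplace⟩

/-- A measurable set without the zero path depends on countably many coordinates, so it is covered
by countably many of the sets `{y | y x ≠ 0}`. -/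
theorem unique (h : IsProcessLevyMeasure ν μ) (h' : IsProcessLevyMeasure ν' μ) : ν = ν' := by
  refine Measure.ext fun A hA => ?_
  rw [h.inner A hA, h'.inner A hA]
  refine iSup_congr fun B => iSup_congr fun hB => iSup_congr fun hBA => ?_
  obtain ⟨J, hJ, hdep⟩ := exists_countable_dependsOn hB
  have hcover : B ⊆ ⋃ x ∈ J, {y | y x ≠ 0} := by
    intro y hy
    by_contra hcon
    simp only [mem_iUnion, mem_ofPred_eq, not_exists, not_not] at hcon
    have hzero : (0 : E → ℝ≥0) ∈ B := (hdep (y := 0) fun x hx => hcon x hx).mp hy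
    exact (hBA hzero).2 rfl
  have hrestrict := (Measure.restrict_biUnion_congr (μ := ν) (ν := ν') (s := J)
    (t := fun x : E => {y : E → ℝ≥0 | y x ≠ 0}) hJ).2
    fun x _ => h.hasLevyLaplace.restrict_eval_ne_zero_eq h'.hasLevyLaplace x
  rw [← inter_eq_left.2 hcover, ← Measure.restrict_apply hB, ← Measure.restrict_apply hB, hrestrict]

end IsProcessLevyMeasure

end Uniqueness

/-! ### One-dimensional laws of a subordinator -/

theorem eq_mul_of_monotone_of_add {c : ℝ≥0 → ℝ} (hmono : Monotone c)
    (hadd : ∀ s t, c (s + t) = c s + c t) (t : ℝ≥0) : c t = t * c 1 := by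
  have hzero : c 0 = 0 := by simpa using hadd 0 0
  have hnat (n : ℕ) (s : ℝ≥0) : c (n * s) = n * c s := by
    induction n with
    | zero => simp [hzero]
    | succ n ih => push_cast; rw [add_mul, one_mul, hadd, ih]; ring
  have hone : 0 ≤ c 1 := hzero ▸ hmono zero_le
  have hbound (n : ℕ) : n • |c t - t * c 1| ≤ c 1 := by
    set k := ⌊n * t⌋₊
    have hfloor : (k : ℝ≥0) ≤ n * t := Nat.floor_le zero_le
    have hceil : n * t ≤ k + 1 := (Nat.lt_floor_add_one (n * t)).le
    have hcast : c k = k * c 1 := by simpa using hnat k 1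
    have hlo : k * c 1 ≤ n * c t := by simpa only [hnat, hcast] using hmono hfloor
    have hhi : n * c t ≤ k * c 1 + c 1 := by simpa only [hnat, hadd, hcast] using hmono hceil
    have hfloor' : (k : ℝ) * c 1 ≤ n * t * c 1 := by gcongr; exact_mod_cast hfloor
    have hceil' : n * t * c 1 ≤ ((k : ℝ) + 1) * c 1 := by gcongr; exact_mod_cast hceil
    rw [nsmul_eq_mul, ← Nat.abs_cast, ← abs_mul, abs_le]
    constructor <;> linarith
  by_contra hne
  obtain ⟨n, hn⟩ := Archimedean.arch (c 1 + 1) (abs_pos.2 (sub_ne_zero.2 hne))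
  linarith [hbound n]

/-- The Laplace exponent `u ↦ ∫ (1 - e^{-ux}) ρ(dx)`. -/
noncomputable def laplaceExponent (ρ : Measure ℝ≥0) (u : ℝ≥0) : ℝ :=
  ∫ x, (1 - Real.exp (-((u : ℝ) * x))) ∂ρ

theorem IsDriftlessLevyMeasure.integrable_one_sub_exp_neg {ρ μ : Measure ℝ≥0}
    (h : IsDriftlessLevyMeasure ρ μ) (u : ℝ≥0) :
    Integrable (fun x : ℝ≥0 => 1 - Real.exp (-((u : ℝ) * x))) ρ := by
  simpa using integrable_one_sub_exp_neg_of_lintegral_min_lt_top (measurable_id.const_mul u)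
    (lintegral_min_const_mul_lt_top measurable_id h.finite u)

namespace Subordinator

variable {Ω : Type*} [MeasurableSpace Ω] {P : Measure Ω} (Z : Subordinator P) {ρ : Measure ℝ≥0}

theorem integral_exp_neg_mul_increment (u s t : ℝ≥0) :
    ∫ ω, Real.exp (-((u : ℝ) * ((Z.val (s + t) ω : ℝ) - Z.val s ω))) ∂P =
      ∫ ω, Real.exp (-((u : ℝ) * Z.val t ω)) ∂P := by
  have hZ := Z.measurable_val
  have hlaw := congrArg (fun m : Measure ℝ => ∫ r, Real.exp (-((u : ℝ) * r)) ∂m) (Z.stationary s t)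
  rwa [integral_map (by fun_prop) (by fun_prop), integral_map (by fun_prop) (by fun_prop)] at hlaw

theorem integral_exp_neg_mul_val_add (u s t : ℝ≥0) :
    ∫ ω, Real.exp (-((u : ℝ) * Z.val (s + t) ω)) ∂P =
      (∫ ω, Real.exp (-((u : ℝ) * Z.val s ω)) ∂P) *
        ∫ ω, Real.exp (-((u : ℝ) * Z.val t ω)) ∂P := by
  have hZ := Z.measurable_val
  have hind := Z.indep.indepFun_eval_sub (r := 0) (s := s) (t := s + t) zero_le le_self_add (by
    filter_upwards [Z.zero_ae] with ω hω
    simp [hω])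
  have hmul := hind.integral_fun_comp_mul_comp (f := fun r : ℝ => Real.exp (-((u : ℝ) * r)))
    (g := fun r : ℝ => Real.exp (-((u : ℝ) * r))) (by fun_prop)
    (Measurable.aemeasurable (by fun_prop)) (by fun_prop) (by fun_prop)
  simp only [Pi.sub_apply] at hmul
  rw [← Z.integral_exp_neg_mul_increment u s t, ← hmul]
  refine integral_congr_ae (ae_of_all _ fun ω => ?_)
  simp only [← Real.exp_add]
  congr 1
  ring

variable [IsProbabilityMeasure P]

theorem integral_exp_neg_mul_val (hρ : IsDriftlessLevyMeasure ρ (P.map (Z.val 1))) (u t : ℝ≥0) :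
    ∫ ω, Real.exp (-((u : ℝ) * Z.val t ω)) ∂P = Real.exp (-(t * laplaceExponent ρ u)) := by
  have hint (s : ℝ≥0) : Integrable (fun ω => Real.exp (-((u : ℝ) * Z.val s ω))) P := by
    simpa using integrable_exp_neg ((Z.measurable_val s).const_mul u)
  have hpos (s : ℝ≥0) : 0 < ∫ ω, Real.exp (-((u : ℝ) * Z.val s ω)) ∂P := integral_exp_pos (hint s)
  have hlinear := eq_mul_of_monotone_of_add
    (c := fun s => -Real.log (∫ ω, Real.exp (-((u : ℝ) * Z.val s ω)) ∂P))
    (fun s r hsr => neg_le_neg (Real.log_le_log (hpos r)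
      (integral_mono (hint r) (hint s) fun ω => by
        have hle : Z.val s ω ≤ Z.val r ω := Z.mono ω hsr
        dsimp only
        gcongr)))
    (fun s r => by
      rw [Z.integral_exp_neg_mul_val_add, Real.log_mul (hpos s).ne' (hpos r).ne', neg_add]) t
  have hone : ∫ ω, Real.exp (-((u : ℝ) * Z.val 1 ω)) ∂P = Real.exp (-laplaceExponent ρ u) := by
    have hlaplace := hρ.laplace u
    rwa [integral_map (Z.measurable_val 1).aemeasurable (by fun_prop)] at hlaplace
  simp only [hone, Real.log_exp, neg_neg] at hlinear
  rw [← hlinear, neg_neg, Real.exp_log (hpos t)]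

theorem integral_exp_neg_mul_sub (hρ : IsDriftlessLevyMeasure ρ (P.map (Z.val 1))) (u : ℝ≥0)
    {s t : ℝ≥0} (hst : s ≤ t) :
    ∫ ω, Real.exp (-((u : ℝ) * ((Z.val t ω : ℝ) - Z.val s ω))) ∂P =
      Real.exp (-(((t : ℝ) - s) * laplaceExponent ρ u)) := by
  obtain ⟨r, rfl⟩ := exists_add_of_le hst
  rw [Z.integral_exp_neg_mul_increment, Z.integral_exp_neg_mul_val hρ]
  simp

theorem lintegral_val_eq_mul_lintegral (hρ : IsDriftlessLevyMeasure ρ (P.map (Z.val 1)))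
    (t : ℝ≥0) : ∫⁻ ω, Z.val t ω ∂P = t * ∫⁻ x, x ∂ρ := by
  have hmean := lintegral_eq_mul_lintegral_of_laplace_eq (m := P) (k := t • ρ)
    (Z.measurable_val t) measurable_id
    (fun u => (hρ.integrable_one_sub_exp_neg u).smul_measure_nnreal)
    fun u => by
      rw [Z.integral_exp_neg_mul_val hρ, integral_smul_nnreal_measure]
      simp [laplaceExponent, NNReal.smul_def]
  rwa [measure_univ, one_mul, lintegral_smul_measure] at hmean

theorem mean_eq_lintegral (hρ : IsDriftlessLevyMeasure ρ (P.map (Z.val 1))) :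
    Z.mean = ∫⁻ x, x ∂ρ := by
  simpa [mean] using Z.lintegral_val_eq_mul_lintegral hρ 1

theorem lintegral_val (hρ : IsDriftlessLevyMeasure ρ (P.map (Z.val 1))) (t : ℝ≥0) :
    ∫⁻ ω, Z.val t ω ∂P = t * Z.mean := by
  rw [Z.mean_eq_lintegral hρ, Z.lintegral_val_eq_mul_lintegral hρ]

end Subordinator

/-! ### The random measure `dZ` and its mean -/

namespace Subordinator

variable {Ω : Type*} [MeasurableSpace Ω] {P : Measure Ω} (Z : Subordinator P) {ρ : Measure ℝ≥0}

theorem stieltjes_Ioc (ω : Ω) (a b : ℝ) :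
    (Z.stieltjes ω).measure (Ioc a b) =
      ENNReal.ofReal ((Z.val b.toNNReal ω : ℝ) - Z.val a.toNNReal ω) :=
  StieltjesFunction.measure_Ioc _ _ _

theorem measurable_stieltjes_Ioc (a b : ℝ) :
    Measurable fun ω => (Z.stieltjes ω).measure (Ioc a b) := by
  have hZ := Z.measurable_val
  simp_rw [Z.stieltjes_Ioc]
  fun_prop

theorem measurable_stieltjes_restrict (T : ℝ) :
    Measurable fun ω => (Z.stieltjes ω).measure.restrict (Ioc 0 T) := by
  have hfin (ω : Ω) : IsFiniteMeasure ((Z.stieltjes ω).measure.restrict (Ioc 0 T)) :=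
    isFiniteMeasure_restrict.2 measure_Ioc_lt_top.ne
  refine Measurable.measure_of_isPiSystem (S := {S | ∃ l u, l < u ∧ Ioc l u = S})
    (by rw [← borel_eq_generateFrom_Ioc ℝ]; exact BorelSpace.measurable_eq)
    (isPiSystem_Ioc id id) ?_ ?_
  · rintro _ ⟨a, b, _, rfl⟩
    simp_rw [Measure.restrict_apply measurableSet_Ioc, Ioc_inter_Ioc]
    exact Z.measurable_stieltjes_Ioc _ _
  · simp_rw [Measure.restrict_apply_univ]
    exact Z.measurable_stieltjes_Ioc _ _

theorem measurable_setLIntegral_stieltjes (T : ℝ) {h : ℝ → ℝ≥0∞} (hh : Measurable h) :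
    Measurable fun ω => ∫⁻ s in Ioc 0 T, h s ∂(Z.stieltjes ω).measure :=
  (Measure.measurable_lintegral hh).comp (Z.measurable_stieltjes_restrict T)

variable [IsProbabilityMeasure P]

theorem lintegral_increment (hρ : IsDriftlessLevyMeasure ρ (P.map (Z.val 1)))
    (hκ : Z.mean ≠ ∞) {s t : ℝ≥0} (hst : s ≤ t) :
    ∫⁻ ω, ENNReal.ofReal ((Z.val t ω : ℝ) - Z.val s ω) ∂P =
      Z.mean * ENNReal.ofReal ((t : ℝ) - s) := by
  have hZ := Z.measurable_val
  have hsplit : ∫⁻ ω, Z.val t ω ∂P = ∫⁻ ω, Z.val s ω ∂P +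
      ∫⁻ ω, ENNReal.ofReal ((Z.val t ω : ℝ) - Z.val s ω) ∂P := by
    rw [← lintegral_add_left (by fun_prop)]
    refine lintegral_congr fun ω => ?_
    have hle : (Z.val s ω : ℝ) ≤ Z.val t ω := Z.mono ω hst
    rw [← ENNReal.ofReal_coe_nnreal, ← ENNReal.ofReal_coe_nnreal,
      ← ENNReal.ofReal_add (NNReal.coe_nonneg _) (sub_nonneg.2 hle), add_sub_cancel]
  obtain ⟨r, rfl⟩ := exists_add_of_le hst
  rw [Z.lintegral_val hρ, Z.lintegral_val hρ, ENNReal.coe_add, add_mul,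
    ENNReal.add_right_inj (ENNReal.mul_ne_top ENNReal.coe_ne_top hκ)] at hsplit
  simp [← hsplit, mul_comm]

theorem lintegral_stieltjes_Ioc (hρ : IsDriftlessLevyMeasure ρ (P.map (Z.val 1)))
    (hκ : Z.mean ≠ ∞) {a : ℝ} (ha : 0 ≤ a) (b : ℝ) :
    ∫⁻ ω, (Z.stieltjes ω).measure (Ioc a b) ∂P = Z.mean * volume (Ioc a b) := by
  rcases le_total a b with hab | hab
  · simp_rw [Z.stieltjes_Ioc]
    rw [Z.lintegral_increment hρ hκ (Real.toNNReal_mono hab), Real.volume_Ioc,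
      Real.coe_toNNReal _ ha, Real.coe_toNNReal _ (ha.trans hab)]
  · simp [Ioc_eq_empty_of_le hab]

theorem bind_stieltjes_restrict (hρ : IsDriftlessLevyMeasure ρ (P.map (Z.val 1)))
    (hκ : Z.mean ≠ ∞) (T : ℝ) :
    (P.bind fun ω => (Z.stieltjes ω).measure.restrict (Ioc 0 T)) =
      Z.mean • volume.restrict (Ioc 0 T) := by
  have hmeas := (Z.measurable_stieltjes_restrict T).aemeasurable (μ := P)
  have huniv : (P.bind fun ω => (Z.stieltjes ω).measure.restrict (Ioc 0 T)) univ =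
      Z.mean * volume (Ioc 0 T) := by
    simp_rw [Measure.bind_apply MeasurableSet.univ hmeas, Measure.restrict_apply_univ,
      Z.lintegral_stieltjes_Ioc hρ hκ le_rfl]
  have : IsFiniteMeasure (P.bind fun ω => (Z.stieltjes ω).measure.restrict (Ioc 0 T)) :=
    ⟨huniv ▸ ENNReal.mul_lt_top hκ.lt_top measure_Ioc_lt_top⟩
  refine Measure.ext_of_Ioc_finite _ _ (by simpa using huniv) fun a b _ => ?_
  simp_rw [Measure.bind_apply measurableSet_Ioc hmeas, Measure.smul_apply,
    Measure.restrict_apply measurableSet_Ioc, Ioc_inter_Ioc,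
    Z.lintegral_stieltjes_Ioc hρ hκ le_sup_right, smul_eq_mul]

theorem lintegral_setLIntegral_stieltjes (hρ : IsDriftlessLevyMeasure ρ (P.map (Z.val 1)))
    (hκ : Z.mean ≠ ∞) (T : ℝ) {h : ℝ → ℝ≥0∞} (hh : Measurable h) :
    ∫⁻ ω, ∫⁻ s in Ioc 0 T, h s ∂(Z.stieltjes ω).measure ∂P =
      Z.mean * ∫⁻ s in Ioc 0 T, h s := by
  rw [← Measure.lintegral_bind (Z.measurable_stieltjes_restrict T).aemeasurable hh.aemeasurable,
    Z.bind_stieltjes_restrict hρ hκ, lintegral_smul_measure, smul_eq_mul]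

theorem ae_setLIntegral_stieltjes_lt_top (hρ : IsDriftlessLevyMeasure ρ (P.map (Z.val 1)))
    (hκ : Z.mean ≠ ∞) {T : ℝ} {h : ℝ → ℝ≥0∞} (hh : Measurable h)
    (hfin : ∫⁻ s in Ioc 0 T, h s ≠ ∞) :
    ∀ᵐ ω ∂P, ∫⁻ s in Ioc 0 T, h s ∂(Z.stieltjes ω).measure < ∞ := by
  refine ae_lt_top (Z.measurable_setLIntegral_stieltjes T hh) ?_
  rw [Z.lintegral_setLIntegral_stieltjes hρ hκ T hh]
  exact ENNReal.mul_ne_top hκ hfin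

end Subordinator

/-! ### The Laplace functional of `dZ` -/

theorem lipschitzOnWith_exp_neg : LipschitzOnWith 1 (fun r : ℝ => Real.exp (-r)) (Ici 0) := by
  refine Convex.lipschitzOnWith_of_nnnorm_deriv_le (fun r _ => by fun_prop) (fun r hr => ?_)
    (convex_Ici 0)
  rw [deriv_exp (by fun_prop), deriv_neg, ← NNReal.coe_le_coe]
  simpa using hr

theorem edist_exp_neg_le {a b : ℝ} (ha : 0 ≤ a) (hb : 0 ≤ b) :
    edist (Real.exp (-a)) (Real.exp (-b)) ≤ edist a b := by
  simpa using lipschitzOnWith_exp_neg ha hb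

theorem laplaceExponent_zero (ρ : Measure ℝ≥0) : laplaceExponent ρ 0 = 0 := by
  simp [laplaceExponent]

theorem laplaceExponent_nonneg (ρ : Measure ℝ≥0) (u : ℝ≥0) : 0 ≤ laplaceExponent ρ u :=
  integral_nonneg fun _ => one_sub_exp_neg_nonneg (by positivity)

theorem edist_laplaceExponent_le {ρ : Measure ℝ≥0} (hρ : ∫⁻ x, x ∂ρ ≠ ∞) (u v : ℝ≥0) :
    edist (laplaceExponent ρ u) (laplaceExponent ρ v) ≤ (∫⁻ x, x ∂ρ) * edist u v := by
  have hint (r : ℝ≥0) : Integrable (fun x : ℝ≥0 => 1 - Real.exp (-((r : ℝ) * x))) ρ := by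
    refine mod_cast integrable_one_sub_exp_neg (measurable_id.const_mul r) ?_
    simp only [ENNReal.coe_mul]
    rw [lintegral_const_mul _ (by fun_prop)]
    exact ENNReal.mul_lt_top ENNReal.coe_lt_top hρ.lt_top
  rw [← lintegral_mul_const _ (by fun_prop)]
  refine (edist_integral_le_lintegral_edist (hint u) (hint v)).trans (lintegral_mono fun x => ?_)
  rw [edist_sub_left]
  refine (edist_exp_neg_le (by positivity) (by positivity)).trans_eq ?_
  rw [edist_dist, Real.dist_eq, ← sub_mul, abs_mul, NNReal.abs_eq, mul_comm,
    ENNReal.ofReal_mul (by positivity), ENNReal.ofReal_coe_nnreal, edist_dist, NNReal.dist_eq]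

theorem lipschitzWith_laplaceExponent {ρ : Measure ℝ≥0} (hρ : ∫⁻ x, x ∂ρ ≠ ∞) :
    LipschitzWith (∫⁻ x, x ∂ρ).toNNReal (laplaceExponent ρ) := fun u v => by
  rw [ENNReal.coe_toNNReal hρ]
  exact edist_laplaceExponent_le hρ u v

section L1

variable {X : Type*} [MeasurableSpace X] {m : Measure X} {g h : X → ℝ≥0}

theorem toReal_lintegral_coe (m : Measure X) (hg : Measurable g) :
    (∫⁻ s, g s ∂m).toReal = ∫ s, (g s : ℝ) ∂m := by
  simpa using (integral_toReal hg.coe_nnreal_ennreal.aemeasurable (by simp)).symm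

theorem edist_toReal_lintegral_le (hg : Measurable g) (hh : Measurable h)
    (hgfin : ∫⁻ s, g s ∂m < ∞) (hhfin : ∫⁻ s, h s ∂m < ∞) :
    edist (∫⁻ s, g s ∂m).toReal (∫⁻ s, h s ∂m).toReal ≤ ∫⁻ s, edist (g s) (h s) ∂m := by
  rw [toReal_lintegral_coe m hg, toReal_lintegral_coe m hh]
  exact edist_integral_le_lintegral_edist (integrable_coe_of_lintegral_lt_top hg hgfin)
    (integrable_coe_of_lintegral_lt_top hh hhfin)

theorem integrable_laplaceExponent_comp {ρ : Measure ℝ≥0} (hρ : ∫⁻ x, x ∂ρ ≠ ∞)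
    (hg : Measurable g) (hgfin : ∫⁻ s, g s ∂m < ∞) :
    Integrable (fun s => laplaceExponent ρ (g s)) m := by
  refine ⟨((lipschitzWith_laplaceExponent hρ).continuous.measurable.comp hg).aestronglyMeasurable,
    ?_⟩
  refine (lintegral_mono (g := fun s => (∫⁻ x, x ∂ρ) * (g s : ℝ≥0∞)) fun s => ?_).trans_lt ?_
  · simpa [laplaceExponent_zero, edist_zero_right, edist_nndist (g s),
      NNReal.nndist_zero_eq_val'] using edist_laplaceExponent_le hρ (g s) 0
  · rw [lintegral_const_mul _ hg.coe_nnreal_ennreal]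
    exact ENNReal.mul_lt_top hρ.lt_top hgfin

theorem edist_exp_neg_integral_laplaceExponent_le {ρ : Measure ℝ≥0} (hρ : ∫⁻ x, x ∂ρ ≠ ∞)
    (hg : Measurable g) (hh : Measurable h)
    (hgfin : ∫⁻ s, g s ∂m < ∞) (hhfin : ∫⁻ s, h s ∂m < ∞) :
    edist (Real.exp (-∫ s, laplaceExponent ρ (g s) ∂m))
      (Real.exp (-∫ s, laplaceExponent ρ (h s) ∂m)) ≤
      (∫⁻ x, x ∂ρ) * ∫⁻ s, edist (g s) (h s) ∂m := by
  rw [← lintegral_const_mul _ (hg.edist hh)]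
  calc _ ≤ _ := edist_exp_neg_le (integral_nonneg fun _ => laplaceExponent_nonneg _ _)
        (integral_nonneg fun _ => laplaceExponent_nonneg _ _)
    _ ≤ _ := edist_integral_le_lintegral_edist (integrable_laplaceExponent_comp hρ hg hgfin)
        (integrable_laplaceExponent_comp hρ hh hhfin)
    _ ≤ _ := lintegral_mono fun s => edist_laplaceExponent_le hρ _ _

end L1

/-- The right end point of the cell of the grid `M⁻¹ ℕ` which contains `s`. -/
noncomputable def gridPoint (M : ℕ) (s : ℝ) : ℝ := (⌈M * s⌉₊ : ℝ) / M

@[fun_prop]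
theorem measurable_gridPoint (M : ℕ) : Measurable (gridPoint M) :=
  (measurable_from_nat.comp (Nat.measurable_ceil.comp (measurable_id.const_mul _))).div_const _

theorem gridPoint_of_mem_Ioc {M : ℕ} (hM : 0 < M) {j : ℕ} {s : ℝ}
    (hs : s ∈ Ioc ((j : ℝ) / M) ((j + 1 : ℕ) / M)) : gridPoint M s = (j + 1 : ℕ) / M := by
  have hM' : (0 : ℝ) < M := mod_cast hM
  have hceil : ⌈M * s⌉₊ = j + 1 := by
    rw [mem_Ioc, div_lt_iff₀' hM', le_div_iff₀' hM'] at hs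
    rw [Nat.ceil_eq_iff (by simp)]
    simpa using hs
  rw [gridPoint, hceil]

theorem dist_gridPoint_le {M : ℕ} (hM : 0 < M) {s : ℝ} (hs : 0 ≤ s) :
    dist s (gridPoint M s) ≤ 1 / M := by
  have hM' : (0 : ℝ) < M := mod_cast hM
  have hle : M * s ≤ ⌈M * s⌉₊ := Nat.le_ceil _
  have hlt : (⌈M * s⌉₊ : ℝ) < M * s + 1 := Nat.ceil_lt_add_one (by positivity)
  have hdiff : gridPoint M s - s = (⌈M * s⌉₊ - M * s) / M := by
    rw [gridPoint]
    field_simp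
  rw [dist_comm, Real.dist_eq, hdiff, abs_of_nonneg (by apply div_nonneg <;> linarith)]
  gcongr
  linarith

theorem setIntegral_comp_gridPoint (m : Measure ℝ) [IsLocallyFiniteMeasure m] (G : ℝ → ℝ) {M : ℕ}
    (hM : 0 < M) (j : ℕ) :
    IntegrableOn (fun s => G (gridPoint M s)) (Ioc 0 ((j : ℝ) / M)) m ∧
    ∫ s in Ioc 0 ((j : ℝ) / M), G (gridPoint M s) ∂m =
      ∑ k : Fin j, G ((k + 1 : ℕ) / M) * m.real (Ioc ((k : ℝ) / M) ((k + 1 : ℕ) / M)) := by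
  induction j with
  | zero => simp
  | succ j ih =>
    have hunion : Ioc (0 : ℝ) ((j + 1 : ℕ) / M) =
        Ioc 0 ((j : ℝ) / M) ∪ Ioc ((j : ℝ) / M) ((j + 1 : ℕ) / M) := by
      rw [Ioc_union_Ioc_eq_Ioc (by positivity)]
      gcongr
      simp
    have hconst : EqOn (fun s => G (gridPoint M s)) (fun _ => G ((j + 1 : ℕ) / M))
        (Ioc ((j : ℝ) / M) ((j + 1 : ℕ) / M)) := fun s hs => by
      simp only [gridPoint_of_mem_Ioc hM hs]
    have hint : IntegrableOn (fun s => G (gridPoint M s))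
        (Ioc ((j : ℝ) / M) ((j + 1 : ℕ) / M)) m :=
      (integrableOn_congr_fun hconst measurableSet_Ioc).2
        (integrableOn_const measure_Ioc_lt_top.ne)
    rw [hunion]
    refine ⟨ih.1.union hint, ?_⟩
    rw [setIntegral_union (Ioc_disjoint_Ioc_of_le le_rfl) measurableSet_Ioc ih.1 hint, ih.2,
      setIntegral_congr_fun measurableSet_Ioc hconst, Fin.sum_univ_castSucc]
    simp [mul_comm]

theorem setLIntegral_comp_gridPoint_lt_top (h : ℝ → ℝ≥0) {M : ℕ} (hM : 0 < M) (T : ℕ) :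
    ∫⁻ s in Ioc 0 (T : ℝ), h (gridPoint M s) < ∞ := by
  have hint := (setIntegral_comp_gridPoint volume (fun s => (h s : ℝ)) hM (T * M)).1
  rw [Nat.cast_mul, mul_div_cancel_right₀ _ (by positivity)] at hint
  simpa [HasFiniteIntegral] using hint.2

theorem exists_lintegral_edist_comp_gridPoint_le {g : ℝ → ℝ≥0} (hg : Measurable g) {T : ℕ}
    (hfin : ∫⁻ s in Ioc 0 (T : ℝ), g s < ∞) {ε : ℝ≥0} (hε : 0 < ε) :
    ∃ (h : ℝ → ℝ≥0) (M : ℕ), Continuous h ∧ 0 < M ∧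
      ∫⁻ s in Ioc 0 (T : ℝ), edist (g s) (h (gridPoint M s)) ≤ ε * (1 + T) := by
  obtain ⟨k, hsupp, hgk, hk, -⟩ := (integrable_coe_of_lintegral_lt_top hg hfin)
    |>.exists_hasCompactSupport_lintegral_sub_le (ε := ε) (by simpa using hε.ne')
  obtain ⟨δ, hδ, hkδ⟩ := Metric.uniformContinuous_iff.1
    (hsupp.uniformContinuous_of_continuous hk) ε hε
  obtain ⟨n, hn⟩ := exists_nat_one_div_lt hδ
  have hgrid (s : ℝ) (hs : s ∈ Ioc 0 (T : ℝ)) :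
      edist (g s) (k (gridPoint (n + 1) s)).toNNReal ≤ ‖(g s : ℝ) - k s‖ₑ + ε := by
    have hclose : edist (k s) (k (gridPoint (n + 1) s)) ≤ ε := by
      rw [edist_dist]
      refine ENNReal.ofReal_le_of_le_toReal (hkδ ?_).le
      exact (dist_gridPoint_le n.succ_pos hs.1.le).trans_lt (mod_cast hn)
    calc edist (g s) (k (gridPoint (n + 1) s)).toNNReal
        ≤ edist (g s : ℝ) (k (gridPoint (n + 1) s)) := by
          simpa using Real.lipschitzWith_toNNReal (g s : ℝ) (k (gridPoint (n + 1) s))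
      _ ≤ edist (g s : ℝ) (k s) + edist (k s) (k (gridPoint (n + 1) s)) := edist_triangle _ _ _
      _ ≤ _ := by rw [edist_eq_enorm_sub (g s : ℝ)]; gcongr
  refine ⟨fun s => (k s).toNNReal, n + 1, by fun_prop, n.succ_pos, ?_⟩
  calc ∫⁻ s in Ioc 0 (T : ℝ), edist (g s) (k (gridPoint (n + 1) s)).toNNReal
      ≤ ∫⁻ s in Ioc 0 (T : ℝ), (‖(g s : ℝ) - k s‖ₑ + ε) :=
        setLIntegral_mono' measurableSet_Ioc hgrid
    _ ≤ ε + ε * T := by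
        rw [lintegral_add_right _ measurable_const]
        gcongr
        simp
    _ = ε * (1 + T) := by ring

namespace Subordinator

variable {Ω : Type*} [MeasurableSpace Ω] {P : Measure Ω} [IsProbabilityMeasure P]
  (Z : Subordinator P) {ρ : Measure ℝ≥0}

theorem integral_exp_neg_sum_increment (hρ : IsDriftlessLevyMeasure ρ (P.map (Z.val 1))) {j : ℕ}
    {t : Fin (j + 1) → ℝ≥0} (ht : Monotone t) (u : Fin j → ℝ≥0) :
    ∫ ω, Real.exp (-∑ k, (u k : ℝ) * ((Z.val (t k.succ) ω : ℝ) - Z.val (t k.castSucc) ω)) ∂P =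
      Real.exp (-∑ k, ((t k.succ : ℝ) - t k.castSucc) * laplaceExponent ρ (u k)) := by
  have hZ := Z.measurable_val
  have hprod := (Z.indep j t ht).integral_fun_prod_comp
    (f := fun k (r : ℝ) => Real.exp (-((u k : ℝ) * r)))
    (fun _ => Measurable.aemeasurable (by fun_prop))
    (fun _ => Measurable.aestronglyMeasurable (by fun_prop))
  simp only [← Real.exp_sum, Finset.sum_neg_distrib] at hprod
  rw [hprod, ← Finset.sum_neg_distrib, Real.exp_sum]
  exact Finset.prod_congr rfl fun k _ =>
    Z.integral_exp_neg_mul_sub hρ _ (ht (Fin.castSucc_lt_succ (i := k)).le)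

theorem integral_exp_neg_setIntegral_comp_gridPoint
    (hρ : IsDriftlessLevyMeasure ρ (P.map (Z.val 1))) (h : ℝ → ℝ≥0) {M : ℕ} (hM : 0 < M) (j : ℕ) :
    ∫ ω, Real.exp (-∫ s in Ioc 0 ((j : ℝ) / M), (h (gridPoint M s) : ℝ)
        ∂(Z.stieltjes ω).measure) ∂P =
      Real.exp (-∫ s in Ioc 0 ((j : ℝ) / M), laplaceExponent ρ (h (gridPoint M s))) := by
  let t : Fin (j + 1) → ℝ≥0 := fun i => (i : ℕ) / M
  have ht : Monotone t := fun a b hab => by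
    have : (a : ℕ) ≤ b := hab
    simp only [t]
    gcongr
  have htoNNReal (k : ℕ) : ((k : ℝ) / M).toNNReal = (k : ℝ≥0) / M := by
    simp [Real.toNNReal_div]
  have hincr (k : Fin j) (ω : Ω) :
      (Z.stieltjes ω).measure.real (Ioc ((k : ℝ) / M) ((k + 1 : ℕ) / M)) =
        (Z.val (t k.succ) ω : ℝ) - Z.val (t k.castSucc) ω := by
    rw [Measure.real, Z.stieltjes_Ioc, htoNNReal, htoNNReal]
    exact ENNReal.toReal_ofReal <| sub_nonneg.2 <| NNReal.coe_le_coe.2 <|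
      Z.mono ω (ht (Fin.castSucc_lt_succ (i := k)).le)
  have hlength (k : Fin j) : volume.real (Ioc ((k : ℝ) / M) ((k + 1 : ℕ) / M)) =
      (t k.succ : ℝ) - t k.castSucc := by
    rw [Real.volume_real_Ioc_of_le (by gcongr; simp)]
    simp [t]
  simp_rw [(setIntegral_comp_gridPoint _ (fun s => (h s : ℝ)) hM j).2,
    (setIntegral_comp_gridPoint _ (fun s => laplaceExponent ρ (h s)) hM j).2, hincr, hlength,
    Z.integral_exp_neg_sum_increment hρ ht, mul_comm]

theorem integral_exp_neg_setLIntegral_comp_gridPoint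
    (hρ : IsDriftlessLevyMeasure ρ (P.map (Z.val 1))) {h : ℝ → ℝ≥0} (hh : Measurable h) {M : ℕ}
    (hM : 0 < M) (T : ℕ) :
    ∫ ω, Real.exp (-(∫⁻ s in Ioc 0 (T : ℝ), h (gridPoint M s) ∂(Z.stieltjes ω).measure).toReal)
        ∂P = Real.exp (-∫ s in Ioc 0 (T : ℝ), laplaceExponent ρ (h (gridPoint M s))) := by
  have hstep := Z.integral_exp_neg_setIntegral_comp_gridPoint hρ h hM (T * M)
  rw [Nat.cast_mul, mul_div_cancel_right₀ _ (by positivity)] at hstep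
  rw [← hstep]
  congr! 4 with ω
  exact toReal_lintegral_coe _ (hh.comp (measurable_gridPoint M))

theorem edist_integral_exp_neg_setLIntegral_le (hρ : IsDriftlessLevyMeasure ρ (P.map (Z.val 1)))
    (hκ : Z.mean ≠ ∞) {T : ℝ} {g h : ℝ → ℝ≥0} (hg : Measurable g) (hh : Measurable h)
    (hgfin : ∫⁻ s in Ioc 0 T, g s < ∞) (hhfin : ∫⁻ s in Ioc 0 T, h s < ∞) :
    edist (∫ ω, Real.exp (-(∫⁻ s in Ioc 0 T, g s ∂(Z.stieltjes ω).measure).toReal) ∂P)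
      (∫ ω, Real.exp (-(∫⁻ s in Ioc 0 T, h s ∂(Z.stieltjes ω).measure).toReal) ∂P) ≤
      Z.mean * ∫⁻ s in Ioc 0 T, edist (g s) (h s) := by
  have hint {k : ℝ → ℝ≥0} (hk : Measurable k) : Integrable (fun ω =>
      Real.exp (-(∫⁻ s in Ioc 0 T, k s ∂(Z.stieltjes ω).measure).toReal)) P :=
    integrable_exp_neg
      (Z.measurable_setLIntegral_stieltjes T hk.coe_nnreal_ennreal).ennreal_toNNReal
  rw [← Z.lintegral_setLIntegral_stieltjes hρ hκ T (hg.edist hh)]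
  refine (edist_integral_le_lintegral_edist (hint hg) (hint hh)).trans (lintegral_mono_ae ?_)
  filter_upwards [Z.ae_setLIntegral_stieltjes_lt_top hρ hκ hg.coe_nnreal_ennreal hgfin.ne,
    Z.ae_setLIntegral_stieltjes_lt_top hρ hκ hh.coe_nnreal_ennreal hhfin.ne] with ω hgω hhω
  exact (edist_exp_neg_le ENNReal.toReal_nonneg ENNReal.toReal_nonneg).trans
    (edist_toReal_lintegral_le hg hh hgω hhω)

-- Both sides are Lipschitz in `g` for the `L¹` distance, and they agree at step functions.
theorem integral_exp_neg_setLIntegral (hρ : IsDriftlessLevyMeasure ρ (P.map (Z.val 1)))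
    (hκ : Z.mean ≠ ∞) {T : ℕ} {g : ℝ → ℝ≥0} (hg : Measurable g)
    (hfin : ∫⁻ s in Ioc 0 (T : ℝ), g s < ∞) :
    ∫ ω, Real.exp (-(∫⁻ s in Ioc 0 (T : ℝ), g s ∂(Z.stieltjes ω).measure).toReal) ∂P =
      Real.exp (-∫ s in Ioc 0 (T : ℝ), laplaceExponent ρ (g s)) := by
  suffices hle : ∀ ε : ℝ≥0, 0 < ε → edist
      (∫ ω, Real.exp (-(∫⁻ s in Ioc 0 (T : ℝ), g s ∂(Z.stieltjes ω).measure).toReal) ∂P)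
      (Real.exp (-∫ s in Ioc 0 (T : ℝ), laplaceExponent ρ (g s))) ≤
      (2 * Z.mean * (1 + T)) * ε by
    have hlim : Tendsto (fun ε : ℝ≥0 => 2 * Z.mean * (1 + T) * ε) (𝓝[>] 0) (𝓝 0) := by
      refine (Continuous.tendsto' ?_ _ _ (by simp)).mono_left nhdsWithin_le_nhds
      exact (ENNReal.continuous_const_mul (by finiteness)).comp ENNReal.continuous_coe
    exact edist_le_zero.1 (ge_of_tendsto hlim (eventually_mem_nhdsWithin.mono hle))
  intro ε hε
  obtain ⟨h, M, hh, hM, hgh⟩ := exists_lintegral_edist_comp_gridPoint_le hg hfin hε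
  have hkmeas : Measurable fun s => h (gridPoint M s) := hh.measurable.comp (measurable_gridPoint M)
  have hkfin := setLIntegral_comp_gridPoint_lt_top h hM T
  calc _ ≤ edist _ _ + edist _ _ := edist_triangle _
          (Real.exp (-∫ s in Ioc 0 (T : ℝ), laplaceExponent ρ (h (gridPoint M s)))) _
    _ ≤ Z.mean * (ε * (1 + T)) + Z.mean * (ε * (1 + T)) := by
        gcongr
        · rw [← Z.integral_exp_neg_setLIntegral_comp_gridPoint hρ hh.measurable hM]
          exact (Z.edist_integral_exp_neg_setLIntegral_le hρ hκ hg hkmeas hfin hkfin).trans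
            (by gcongr)
        · rw [edist_comm, Z.mean_eq_lintegral hρ]
          exact (edist_exp_neg_integral_laplaceExponent_le (Z.mean_eq_lintegral hρ ▸ hκ)
            hg hkmeas hfin hkfin).trans (by gcongr)
    _ = 2 * Z.mean * (1 + T) * ε := by ring

end Subordinator

/-! ### Translates of sets of positive measure -/

theorem measure_inter_preimage_sub_eq_zero_of_dense {A N S : Set ℝ} (hS : Dense S)
    (hN : MeasurableSet N) (hfin : volume N ≠ ∞)
    (h : ∀ q ∈ S, volume (A ∩ (q - ·) ⁻¹' N) = 0) (t : ℝ) :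
    volume (A ∩ (t - ·) ⁻¹' N) = 0 := by
  let reflect : C(ℝ, C(ℝ, ℝ)) := (⟨fun p : ℝ × ℝ => p.1 - p.2, by fun_prop⟩ : C(ℝ × ℝ, ℝ)).curry
  have hpres (r : ℝ) : MeasurePreserving (reflect r) :=
    Measure.measurePreserving_sub_left volume r
  have hlim := tendsto_measure_symmDiff_preimage_nhds_zero (reflect.continuous.tendsto t)
    (.of_forall hpres) (hpres t) hN.nullMeasurableSet hfin
  refine nonpos_iff_eq_zero.1 (le_of_forall_gt_imp_ge_of_dense fun ε hε => ?_)
  obtain ⟨q, hqS, hq⟩ := hS.inter_nhds_nonempty (hlim.eventually_lt_const hε)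
  calc volume (A ∩ (t - ·) ⁻¹' N)
      ≤ volume ((A ∩ (q - ·) ⁻¹' N) ∪ symmDiff (reflect q ⁻¹' N) (reflect t ⁻¹' N)) := by
        refine measure_mono fun s hs => ?_
        by_cases hqs : q - s ∈ N
        · exact Or.inl ⟨hs.1, hqs⟩
        · exact Or.inr (Or.inr ⟨hs.2, hqs⟩)
    _ ≤ volume (A ∩ (q - ·) ⁻¹' N) + volume (symmDiff (reflect q ⁻¹' N) (reflect t ⁻¹' N)) :=
        measure_union_le _ _
    _ ≤ ε := by rw [h q hqS, zero_add]; exact hq.le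

theorem lintegral_measure_inter_preimage_sub (A : Set ℝ) {N : Set ℝ}
    (hN : MeasurableSet N) :
    ∫⁻ t : ℝ, volume (A ∩ (t - ·) ⁻¹' N) = volume A * volume N := by
  have hmeas : Measurable fun p : ℝ × ℝ => N.indicator (1 : ℝ → ℝ≥0∞) (p.1 - p.2) :=
    (measurable_one.indicator hN).comp (measurable_fst.sub measurable_snd)
  calc ∫⁻ t : ℝ, volume (A ∩ (t - ·) ⁻¹' N)
      = ∫⁻ t : ℝ, ∫⁻ s in A, N.indicator 1 (t - s) := lintegral_congr fun t => by
        have hpre : MeasurableSet ((t - ·) ⁻¹' N) := measurable_const_sub t hN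
        rw [inter_comm, ← Measure.restrict_apply hpre, ← lintegral_indicator_one hpre]
        rfl
    _ = ∫⁻ s in A, ∫⁻ t : ℝ, N.indicator 1 (t - s) := lintegral_lintegral_swap hmeas.aemeasurable
    _ = volume A * volume N := by
        simp_rw [lintegral_sub_right_eq_self, lintegral_indicator_one hN, setLIntegral_const]
        exact mul_comm _ _

theorem ae_exists_sub_mem_of_dense {N S : Set ℝ} (hS : Dense S) (hN : MeasurableSet N)
    (hpos : volume N ≠ 0) : ∀ᵐ s : ℝ, ∃ q ∈ S, q - s ∈ N := by
  obtain ⟨N', hN', hN'N, hN'pos, hN'fin⟩ :=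
    Measure.exists_subset_measure_lt_top hN (pos_iff_ne_zero.2 hpos)
  set A : Set ℝ := {s | ∃ q ∈ S, q - s ∈ N}ᶜ
  have hdisj (q : ℝ) (hq : q ∈ S) : A ∩ (q - ·) ⁻¹' N' = ∅ :=
    eq_empty_of_forall_notMem fun s hs => hs.1 ⟨q, hq, hN'N hs.2⟩
  have hnull := measure_inter_preimage_sub_eq_zero_of_dense hS hN' hN'fin.ne
    (fun q hq => by rw [hdisj q hq, measure_empty])
  have hprod := lintegral_measure_inter_preimage_sub A hN'
  simp_rw [hnull, lintegral_zero] at hprod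
  exact (mul_eq_zero.1 hprod.symm).resolve_right hN'pos.ne'

/-! ### The Lévy measure of a stochastic convolution -/

namespace IsDriftlessLevyMeasure

variable {ρ μ : Measure ℝ≥0}

theorem ae_ne_zero (h : IsDriftlessLevyMeasure ρ μ) : ∀ᵐ x ∂ρ, x ≠ 0 :=
  compl_mem_ae_iff.2 h.zero

theorem sFinite (h : IsDriftlessLevyMeasure ρ μ) (hm : ∫⁻ x, x ∂ρ ≠ ∞) : SFinite ρ := by
  have : IsFiniteMeasure (ρ.withDensity fun x => (x : ℝ≥0∞)) := isFiniteMeasure_withDensity hm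
  rw [← withDensity_inv_same (μ := ρ) (f := fun x => (x : ℝ≥0∞)) (by fun_prop)
    (h.ae_ne_zero.mono fun x hx => by simpa using hx) (.of_forall fun x => ENNReal.coe_ne_top)]
  infer_instance

end IsDriftlessLevyMeasure

/-- The image of `ds ρ(dx)`, with `s` in `[0, ∞) ∩ D`, under `(s, x) ↦ x f(· - s)`. It is the Lévy
measure of the process `t ↦ ∫_0^t f(t - s) 1_D(s) dZ_s`, up to a possible mass at the zero path. -/
noncomputable def shiftLevy (f : ℝ → ℝ≥0) (D : Set ℝ) (ρ : Measure ℝ≥0) : Measure (ℝ≥0 → ℝ≥0) :=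
  ((volume.restrict (Ici 0 ∩ D)).prod ρ).map fun p => shiftPath f p.2 p.1

theorem shiftPath_eq_smul (f : ℝ → ℝ≥0) (x : ℝ≥0) (s : ℝ) :
    shiftPath f x s = x • shiftPath f 1 s := by
  ext t
  simp [shiftPath]

section ShiftLevy

variable {f : ℝ → ℝ≥0} {ρ : Measure ℝ≥0} {D : Set ℝ}

theorem measurable_shiftPath (hf : Measurable f) :
    Measurable fun p : ℝ × ℝ≥0 => shiftPath f p.2 p.1 :=
  measurable_pi_iff.2 fun t => by
    simp only [shiftPath]
    fun_prop

theorem lintegral_shiftLevy (hf : Measurable f) [SFinite ρ] (D : Set ℝ)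
    {F : (ℝ≥0 → ℝ≥0) → ℝ≥0∞} (hF : Measurable F) :
    ∫⁻ y, F y ∂(shiftLevy f D ρ) = ∫⁻ s in Ici 0 ∩ D, ∫⁻ x, F (shiftPath f x s) ∂ρ := by
  rw [shiftLevy, lintegral_map hF (measurable_shiftPath hf)]
  exact lintegral_prod _ (hF.comp (measurable_shiftPath hf)).aemeasurable

theorem shiftLevy_smul (f : ℝ → ℝ≥0) (D : Set ℝ) (ρ : Measure ℝ≥0) [SFinite ρ] (c : ℝ≥0∞) :
    shiftLevy f D (c • ρ) = c • shiftLevy f D ρ := by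
  rw [shiftLevy, shiftLevy, Measure.prod_smul_right, Measure.map_smul]

theorem shiftLevy_univ_eq_add (hf : Measurable f) (hD : MeasurableSet D) (ρ : Measure ℝ≥0)
    [SFinite ρ] : shiftLevy f univ ρ = shiftLevy f D ρ + shiftLevy f (Ici 0 \ D) ρ := by
  have hdiff : Ici (0 : ℝ) ∩ (Ici 0 \ D) = Ici 0 \ D := inter_eq_right.2 sdiff_subset
  rw [shiftLevy, shiftLevy, shiftLevy, inter_univ, hdiff,
    ← Measure.map_add _ _ (measurable_shiftPath hf), ← Measure.add_prod,
    Measure.restrict_inter_add_sdiff _ hD]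

theorem setLIntegral_inter_Iic_sub (hfneg : ∀ u < 0, f u = 0) (m : Measure ℝ) (A : Set ℝ)
    (t : ℝ) : ∫⁻ s in A ∩ Iic t, f (t - s) ∂m = ∫⁻ s in A, f (t - s) ∂m := by
  rw [inter_comm, ← setLIntegral_indicator measurableSet_Iic]
  refine lintegral_congr fun s => indicator_apply_eq_self.2 fun hs => ?_
  simp [hfneg (t - s) (sub_neg.2 (not_le.1 hs))]

theorem setLIntegral_Icc_sub (f : ℝ → ℝ≥0) (t : ℝ≥0) :
    ∫⁻ s in Icc 0 (t : ℝ), f (t - s) = primitiveAt f t := by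
  have hpre : ((t : ℝ) - ·) ⁻¹' Icc 0 (t : ℝ) = Icc 0 (t : ℝ) := by simp
  conv_lhs => rw [← hpre]
  exact (Measure.measurePreserving_sub_left volume (t : ℝ)).setLIntegral_comp_preimage_emb
    (measurableEmbedding_subLeft _) (fun s => (f s : ℝ≥0∞)) _

theorem setLIntegral_Ici_sub (hfneg : ∀ u < 0, f u = 0) (t : ℝ≥0) :
    ∫⁻ s in Ici (0 : ℝ), f (t - s) = primitiveAt f t := by
  rw [← setLIntegral_inter_Iic_sub hfneg, Ici_inter_Iic, setLIntegral_Icc_sub]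

theorem lintegral_eval_shiftLevy_ne_top (hf : Measurable f) (hfneg : ∀ u < 0, f u = 0)
    [SFinite ρ] (hρ : ∫⁻ x, x ∂ρ ≠ ∞) (D : Set ℝ) {t : ℝ≥0} (hft : primitiveAt f t ≠ ∞) :
    ∫⁻ y, y t ∂(shiftLevy f D ρ) ≠ ∞ := by
  rw [lintegral_shiftLevy hf D (by fun_prop)]
  simp only [shiftPath, ENNReal.coe_mul]
  simp_rw [lintegral_mul_const _ measurable_coe_nnreal_ennreal]
  rw [lintegral_const_mul _ (by fun_prop)]
  refine ENNReal.mul_ne_top hρ (ne_top_of_le_ne_top hft ?_)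
  rw [← setLIntegral_Ici_sub hfneg]
  exact lintegral_mono_set inter_subset_left

theorem not_ae_eq_zero_of_primitiveAt_pos {a : ℝ≥0} (ha : 0 < primitiveAt f a) :
    ¬ f =ᵐ[volume] 0 := fun h => by
  have hzero : (fun s => (f s : ℝ≥0∞)) =ᵐ[volume] 0 := h.fun_comp ENNReal.ofNNReal
  rw [primitiveAt, lintegral_congr_ae (ae_restrict_of_ae hzero)] at ha
  simp at ha

theorem exists_countable_ae_shiftLevy_ne_zero (hf : Measurable f) (hfneg : ∀ u < 0, f u = 0)
    [SFinite ρ] (hρ : ∀ᵐ x ∂ρ, x ≠ 0) (hf0 : ¬ f =ᵐ[volume] 0) (D : Set ℝ) :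
    ∃ J : Set ℝ≥0, J.Countable ∧ ∀ᵐ y ∂(shiftLevy f D ρ), ∃ t ∈ J, y t ≠ 0 := by
  set Q : Set ℝ := range ((↑) : ℚ → ℝ)
  have hJ : (Real.toNNReal '' Q).Countable := (countable_range _).image _
  refine ⟨Real.toNNReal '' Q, hJ, ?_⟩
  have hS : MeasurableSet {y : ℝ≥0 → ℝ≥0 | ∃ t ∈ Real.toNNReal '' Q, y t ≠ 0} := by
    have hunion : {y : ℝ≥0 → ℝ≥0 | ∃ t ∈ Real.toNNReal '' Q, y t ≠ 0}
        = ⋃ t ∈ Real.toNNReal '' Q, {y | y t ≠ 0} := by ext; simp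
    rw [hunion]
    exact MeasurableSet.biUnion hJ fun t _ => measurableSet_eval_ne_zero t
  rw [shiftLevy, ae_map_iff (measurable_shiftPath hf).aemeasurable hS]
  have htranslate : ∀ᵐ s : ℝ, ∃ q ∈ Q, f (q - s) ≠ 0 :=
    ae_exists_sub_mem_of_dense Rat.denseRange_cast
      (measurableSet_eq_fun hf measurable_const).compl hf0
  have hnonneg : ∀ᵐ s ∂(volume.restrict (Ici 0 ∩ D)), 0 ≤ s :=
    ae_restrict_of_ae_restrict_of_subset inter_subset_left (ae_restrict_mem measurableSet_Ici)
  filter_upwards [Measure.quasiMeasurePreserving_fst.ae (ae_restrict_of_ae htranslate),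
    Measure.quasiMeasurePreserving_fst.ae hnonneg,
    Measure.quasiMeasurePreserving_snd.ae hρ] with p ⟨q, hqQ, hq⟩ hs hx
  have hqs : 0 ≤ q - p.1 := le_of_not_gt fun h => hq (hfneg _ h)
  refine ⟨_, mem_image_of_mem _ hqQ, ?_⟩
  rw [shiftPath, Real.coe_toNNReal _ (by linarith)]
  exact mul_ne_zero hx hq

end ShiftLevy

/-! ### The Lévy–Khintchine representation of a stochastic convolution -/

/-- The integrand `g(s) = 1_D(s) ∑ i, α i f(t i - s)` for which the functional
`∑ i, α i ∫_0^{t i} f(t i - s) 1_D(s) dZ_s` is the single integral `∫ g dZ`. -/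
noncomputable def convKernel {ι : Type*} [Fintype ι] (f : ℝ → ℝ≥0) (D : Set ℝ) (t α : ι → ℝ≥0) :
    ℝ → ℝ≥0 :=
  D.indicator fun s => ∑ i, α i * f (t i - s)

section ConvKernel

variable {ι : Type*} [Fintype ι] {f : ℝ → ℝ≥0} {D : Set ℝ} {ρ : Measure ℝ≥0} {t : ι → ℝ≥0} {T : ℝ}

@[fun_prop]
theorem measurable_convKernel (hf : Measurable f) (hD : MeasurableSet D) (t α : ι → ℝ≥0) :
    Measurable (convKernel f D t α) :=
  Measurable.indicator (by fun_prop) hD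

theorem convKernel_eq_zero_of_lt (hfneg : ∀ u < 0, f u = 0) (ht : ∀ i, t i ≤ T) (α : ι → ℝ≥0)
    {s : ℝ} (hs : T < s) : convKernel f D t α s = 0 :=
  indicator_apply_eq_zero.2 fun _ =>
    Finset.sum_eq_zero fun i _ => by rw [hfneg _ (by linarith [ht i]), mul_zero]

theorem evalSum_shiftPath (t α : ι → ℝ≥0) (f : ℝ → ℝ≥0) (x : ℝ≥0) (s : ℝ) :
    evalSum t α (shiftPath f x s) = (∑ i, α i * f (t i - s)) * x := by
  rw [shiftPath_eq_smul, evalSum_smul, mul_comm]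
  simp [evalSum, shiftPath]

theorem setLIntegral_convKernel (hf : Measurable f) (hfneg : ∀ u < 0, f u = 0)
    (hD : MeasurableSet D) (ht : ∀ i, t i ≤ T) (α : ι → ℝ≥0) (m : Measure ℝ) :
    ∫⁻ s in Ioc 0 T, convKernel f D t α s ∂m =
      ∑ i, α i * ∫⁻ s in Ioc 0 (t i : ℝ) ∩ D, f (t i - s) ∂m := by
  have htrunc (i : ι) : ∫⁻ s in Ioc 0 (t i : ℝ) ∩ D, f (t i - s) ∂m =
      ∫⁻ s in D ∩ Ioc 0 T, f (t i - s) ∂m := by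
    rw [← setLIntegral_inter_Iic_sub hfneg m (D ∩ Ioc 0 T), inter_assoc, Ioc_inter_Iic,
      min_eq_right (ht i), inter_comm]
  simp only [convKernel, ENNReal.coe_indicator, setLIntegral_indicator hD, htrunc,
    ENNReal.ofNNReal_finsetSum, ENNReal.coe_mul]
  rw [lintegral_finsetSum _ fun i _ => by fun_prop]
  exact Finset.sum_congr rfl fun i _ => lintegral_const_mul _ (by fun_prop)

theorem setLIntegral_convKernel_lt_top (hf : Measurable f) (hfneg : ∀ u < 0, f u = 0)
    (hfint : ∀ r, primitiveAt f r ≠ ∞) (hD : MeasurableSet D) (ht : ∀ i, t i ≤ T)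
    (α : ι → ℝ≥0) : ∫⁻ s in Ioc 0 T, convKernel f D t α s < ∞ := by
  rw [setLIntegral_convKernel hf hfneg hD ht]
  refine ENNReal.sum_lt_top.2 fun i _ =>
    ENNReal.mul_lt_top ENNReal.coe_lt_top ((hfint (t i)).lt_top.trans_le' ?_)
  rw [← setLIntegral_Icc_sub]
  exact lintegral_mono_set (inter_subset_left.trans Ioc_subset_Icc_self)

theorem lintegral_evalSum_shiftLevy_lt_top (hf : Measurable f) (hfneg : ∀ u < 0, f u = 0)
    (hfint : ∀ r, primitiveAt f r ≠ ∞) [SFinite ρ] (hρ : ∫⁻ x, x ∂ρ ≠ ∞) (D : Set ℝ)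
    (t α : ι → ℝ≥0) : ∫⁻ y, evalSum t α y ∂(shiftLevy f D ρ) < ∞ := by
  simp only [evalSum, ENNReal.ofNNReal_finsetSum, ENNReal.coe_mul]
  rw [lintegral_finsetSum _ fun i _ => by fun_prop]
  refine ENNReal.sum_lt_top.2 fun i _ => ?_
  rw [lintegral_const_mul _ (by fun_prop)]
  exact ENNReal.mul_lt_top ENNReal.coe_lt_top
    (lintegral_eval_shiftLevy_ne_top hf hfneg hρ D (hfint _)).lt_top

theorem integral_shiftLevy_eq_setIntegral_laplaceExponent (hf : Measurable f)
    (hfneg : ∀ u < 0, f u = 0) (hfint : ∀ r, primitiveAt f r ≠ ∞) [SFinite ρ]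
    (hρ : ∫⁻ x, x ∂ρ ≠ ∞) (hD : MeasurableSet D) (ht : ∀ i, t i ≤ T) (α : ι → ℝ≥0) :
    ∫ y, (1 - Real.exp (-(evalSum t α y : ℝ))) ∂(shiftLevy f D ρ) =
      ∫ s in Ioc 0 T, laplaceExponent ρ (convKernel f D t α s) := by
  have hint := integrable_one_sub_exp_neg (measurable_evalSum t α)
    (lintegral_evalSum_shiftLevy_lt_top hf hfneg hfint hρ D t α)
  calc ∫ y, (1 - Real.exp (-(evalSum t α y : ℝ))) ∂(shiftLevy f D ρ)
      = ∫ p, (1 - Real.exp (-(evalSum t α (shiftPath f p.2 p.1) : ℝ)))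
          ∂((volume.restrict (Ici 0 ∩ D)).prod ρ) :=
        integral_map (measurable_shiftPath hf).aemeasurable (by fun_prop)
    _ = ∫ s in Ici 0 ∩ D, ∫ x, (1 - Real.exp (-(evalSum t α (shiftPath f x s) : ℝ))) ∂ρ :=
        integral_prod _ (hint.comp_measurable (measurable_shiftPath hf))
    _ = ∫ s in Ici 0 ∩ D, laplaceExponent ρ (convKernel f D t α s) :=
        setIntegral_congr_fun (measurableSet_Ici.inter hD) fun s hs => by
          simp [laplaceExponent, convKernel, hs.2, evalSum_shiftPath]
    _ = ∫ s in Ici 0, laplaceExponent ρ (convKernel f D t α s) :=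
        (setIntegral_eq_of_subset_of_forall_sdiff_eq_zero measurableSet_Ici inter_subset_left
          fun s hs => by
            have hsD : s ∉ D := fun h => hs.2 ⟨hs.1, h⟩
            simp [convKernel, hsD, laplaceExponent_zero]).symm
    _ = ∫ s in Ioi 0, laplaceExponent ρ (convKernel f D t α s) := integral_Ici_eq_integral_Ioi
    _ = ∫ s in Ioc 0 T, laplaceExponent ρ (convKernel f D t α s) :=
        setIntegral_eq_of_subset_of_forall_sdiff_eq_zero measurableSet_Ioi Ioc_subset_Ioi_self
          fun s hs => by
            rw [convKernel_eq_zero_of_lt hfneg ht α (not_le.1 fun h => hs.2 ⟨hs.1, h⟩),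
              laplaceExponent_zero]

end ConvKernel

namespace Subordinator

variable {Ω : Type*} [MeasurableSpace Ω] {P : Measure Ω} (Z : Subordinator P) {f : ℝ → ℝ≥0}
  {D : Set ℝ} {ρ : Measure ℝ≥0}

theorem measurable_convOn (hf : Measurable f) (hD : MeasurableSet D) :
    Measurable fun ω t => Z.convOn f D t ω := by
  refine measurable_pi_iff.2 fun t => Measurable.ennreal_toNNReal ?_
  simp_rw [inter_comm _ D, ← setLIntegral_indicator hD]
  exact Z.measurable_setLIntegral_stieltjes t (Measurable.indicator (by fun_prop) hD)

variable [IsProbabilityMeasure P]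

theorem ae_evalSum_convOn (hρ : IsDriftlessLevyMeasure ρ (P.map (Z.val 1))) (hκ : Z.mean ≠ ∞)
    (hf : Measurable f) (hfneg : ∀ u < 0, f u = 0) (hfint : ∀ r, primitiveAt f r ≠ ∞)
    (hD : MeasurableSet D) {ι : Type*} [Fintype ι] {t : ι → ℝ≥0} {T : ℝ} (ht : ∀ i, t i ≤ T)
    (α : ι → ℝ≥0) :
    ∀ᵐ ω ∂P, evalSum t α (fun r => Z.convOn f D r ω) =
      (∫⁻ s in Ioc 0 T, convKernel f D t α s ∂(Z.stieltjes ω).measure).toNNReal := by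
  filter_upwards [Z.ae_setLIntegral_stieltjes_lt_top hρ hκ
    (measurable_convKernel hf hD t α).coe_nnreal_ennreal
    (setLIntegral_convKernel_lt_top hf hfneg hfint hD ht α).ne] with ω hω
  rw [setLIntegral_convKernel hf hfneg hD ht] at hω ⊢
  rw [ENNReal.toNNReal_sum fun i hi => (ENNReal.sum_lt_top.1 hω i hi).ne]
  simp only [evalSum, convOn, ENNReal.toNNReal_mul, ENNReal.toNNReal_coe]

theorem hasLevyLaplace_convOn (hρ : IsDriftlessLevyMeasure ρ (P.map (Z.val 1)))
    (hκ : Z.mean ≠ ∞) (hf : Measurable f) (hfneg : ∀ u < 0, f u = 0)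
    (hfint : ∀ r, primitiveAt f r ≠ ∞) (hD : MeasurableSet D) :
    HasLevyLaplace (shiftLevy f D ρ) (processLaw P (Z.convOn f D)) := by
  have hm : ∫⁻ x, x ∂ρ ≠ ∞ := by rwa [← Z.mean_eq_lintegral hρ]
  have := hρ.sFinite hm
  refine ⟨fun t => (lintegral_mono fun y => ?_).trans_lt
    (lintegral_eval_shiftLevy_ne_top hf hfneg hm D (hfint t)).lt_top, fun n t α => ?_⟩
  · exact ENNReal.coe_le_coe.2 (min_le_left _ _)
  obtain ⟨T, hT⟩ : ∃ T : ℕ, ∀ i, t i ≤ T := ⟨⌈∑ i, t i⌉₊, fun i =>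
    (Finset.single_le_sum (fun _ _ => zero_le) (Finset.mem_univ i)).trans (Nat.le_ceil _)⟩
  have ht (i : Fin n) : (t i : ℝ) ≤ T := mod_cast hT i
  calc ∫ y, Real.exp (-(evalSum t α y : ℝ)) ∂(processLaw P (Z.convOn f D))
      = ∫ ω, Real.exp (-(evalSum t α (fun r => Z.convOn f D r ω) : ℝ)) ∂P :=
        integral_map (Z.measurable_convOn hf hD).aemeasurable (by fun_prop)
    _ = ∫ ω, Real.exp (-(∫⁻ s in Ioc 0 (T : ℝ), convKernel f D t α s
          ∂(Z.stieltjes ω).measure).toReal) ∂P :=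
        integral_congr_ae <| (Z.ae_evalSum_convOn hρ hκ hf hfneg hfint hD ht α).mono
          fun ω hω => by simp only [hω, ENNReal.coe_toNNReal_eq_toReal]
    _ = Real.exp (-∫ s in Ioc 0 (T : ℝ), laplaceExponent ρ (convKernel f D t α s)) :=
        Z.integral_exp_neg_setLIntegral hρ hκ (by fun_prop)
          (setLIntegral_convKernel_lt_top hf hfneg hfint hD ht α)
    _ = Real.exp (-∫ y, (1 - Real.exp (-(evalSum t α y : ℝ))) ∂(shiftLevy f D ρ)) := by
        rw [integral_shiftLevy_eq_setIntegral_laplaceExponent hf hfneg hfint hm hD ht]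

end Subordinator

/-! ### Infinite divisibility -/

theorem expNegSum_sum {ι κ : Type*} [Fintype ι] [Fintype κ] (c : ι → ℝ≥0) (v : κ → ι → ℝ≥0) :
    expNegSum c (∑ k, v k) = ∏ k, expNegSum c (v k) := by
  simp only [expNegSum_apply, ← Real.exp_sum, Finset.sum_neg_distrib, ← NNReal.coe_sum, evalSum,
    Finset.sum_apply, Finset.mul_sum]
  rw [Finset.sum_comm]

theorem HasLevyLaplace.integral_expNegSum_map_restrict {E : Type*} {ν μ : Measure (E → ℝ≥0)}
    (h : HasLevyLaplace ν μ) (I : Finset E) (c : I → ℝ≥0) :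
    ∫ y, expNegSum c y ∂(μ.map I.restrict) =
      Real.exp (-∫ y, (1 - expNegSum c (I.restrict y)) ∂ν) := by
  rw [integral_map (by fun_prop) (expNegSum c).continuous.aestronglyMeasurable]
  simp only [expNegSum_apply, evalSum_id_restrict, h.laplace]

theorem HasLevyLaplace.isInfDivLaw {E : Type*} {ν μ : Measure (E → ℝ≥0)} (h : HasLevyLaplace ν μ)
    (hroot : ∀ n : ℕ, n ≠ 0 → ∃ η, HasLevyLaplace ((n : ℝ≥0∞)⁻¹ • ν) η) : IsInfDivLaw μ := by
  intro I n hn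
  obtain ⟨η, hη⟩ := hroot n hn.ne'
  have := h.isProbabilityMeasure
  have := hη.isProbabilityMeasure
  have : IsProbabilityMeasure (η.map I.restrict) :=
    Measure.isProbabilityMeasure_map (by fun_prop)
  refine ⟨η.map I.restrict, this, ext_of_integral_expNegSum fun c => ?_⟩
  calc ∫ y, expNegSum c y ∂((Measure.pi fun _ : Fin n => η.map I.restrict).map fun v => ∑ k, v k)
      = ∫ v, ∏ k, expNegSum c (v k) ∂(Measure.pi fun _ : Fin n => η.map I.restrict) := by
        rw [integral_map (by fun_prop) (expNegSum c).continuous.aestronglyMeasurable]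
        simp only [expNegSum_sum]
    _ = (∫ y, expNegSum c y ∂(η.map I.restrict)) ^ n := by
        simpa using integral_fintype_prod_eq_pow (ι := Fin n) (μ := η.map I.restrict) (expNegSum c)
    _ = Real.exp (-∫ y, (1 - expNegSum c (I.restrict y)) ∂ν) := by
        rw [hη.integral_expNegSum_map_restrict, integral_smul_measure, ← Real.exp_nat_mul]
        congr 1
        simp [hn.ne']
    _ = ∫ y, expNegSum c y ∂(μ.map I.restrict) := (h.integral_expNegSum_map_restrict I c).symm

namespace Subordinator

variable {Ω : Type*} [MeasurableSpace Ω] {P : Measure Ω} (Z : Subordinator P) {ρ : Measure ℝ≥0}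

/-- The time-changed subordinator `t ↦ Z_{ct}`. For `c = 1 / n` its Lévy measure is `1 / n` times
that of `Z`, which provides the convolution roots of the laws built from `Z`. -/
def timeScale (c : ℝ≥0) : Subordinator P where
  val t ω := Z.val (c * t) ω
  measurable_val t := Z.measurable_val (c * t)
  zero_ae := by simpa using Z.zero_ae
  mono ω _ _ h := Z.mono ω (mul_le_mul_right h c)
  right_cont ω t := (Z.right_cont ω (c * t)).comp (t := Ici (c * t))
    (by fun_prop : Continuous fun t : ℝ≥0 => c * t).continuousWithinAt
    fun _ hs => mul_le_mul_right hs c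
  indep n t ht := Z.indep n (fun i => c * t i) fun _ _ h => mul_le_mul_right (ht h) c
  stationary s t := by simpa only [mul_add] using Z.stationary (c * s) (c * t)

variable [IsProbabilityMeasure P]

theorem isDriftlessLevyMeasure_timeScale (hρ : IsDriftlessLevyMeasure ρ (P.map (Z.val 1)))
    (c : ℝ≥0) : IsDriftlessLevyMeasure ((c : ℝ≥0∞) • ρ) (P.map ((Z.timeScale c).val 1)) where
  zero := by simp [hρ.zero]
  finite := by
    rw [lintegral_smul_measure]
    exact ENNReal.mul_lt_top ENNReal.coe_lt_top hρ.finite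
  laplace u := by
    rw [integral_map ((Z.timeScale c).measurable_val 1).aemeasurable (by fun_prop),
      integral_smul_measure]
    simpa [timeScale, laplaceExponent] using Z.integral_exp_neg_mul_val hρ u c

theorem mean_timeScale (hρ : IsDriftlessLevyMeasure ρ (P.map (Z.val 1))) (c : ℝ≥0) :
    (Z.timeScale c).mean = c * Z.mean := by
  simpa [mean, timeScale] using Z.lintegral_val hρ c

theorem isInfDivLaw_convOn (hρ : IsDriftlessLevyMeasure ρ (P.map (Z.val 1))) (hκ : Z.mean ≠ ∞)
    {f : ℝ → ℝ≥0} (hf : Measurable f) (hfneg : ∀ u < 0, f u = 0)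
    (hfint : ∀ r, primitiveAt f r ≠ ∞) {D : Set ℝ} (hD : MeasurableSet D) :
    IsInfDivLaw (processLaw P (Z.convOn f D)) := by
  have := hρ.sFinite (by rwa [← Z.mean_eq_lintegral hρ])
  refine (Z.hasLevyLaplace_convOn hρ hκ hf hfneg hfint hD).isInfDivLaw fun n hn =>
    ⟨processLaw P ((Z.timeScale (n : ℝ≥0)⁻¹).convOn f D), ?_⟩
  have hcoe : (n : ℝ≥0∞)⁻¹ = ((n : ℝ≥0)⁻¹ : ℝ≥0) := by
    rw [ENNReal.coe_inv (Nat.cast_ne_zero.2 hn), ENNReal.coe_natCast]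
  rw [hcoe, ← shiftLevy_smul]
  refine hasLevyLaplace_convOn _ (Z.isDriftlessLevyMeasure_timeScale hρ _) ?_ hf hfneg hfint hD
  rw [Z.mean_timeScale hρ]
  exact ENNReal.mul_ne_top ENNReal.coe_ne_top hκ

end Subordinator

/-! ### Size-biasing -/

theorem map_withDensity_comp {α β : Type*} [MeasurableSpace α] [MeasurableSpace β] {m : Measure α}
    {g : α → β} (hg : AEMeasurable g m) {h : β → ℝ≥0∞} (hh : Measurable h) :
    (m.withDensity (h ∘ g)).map g = (m.map g).withDensity h := by
  ext A hA
  rw [Measure.map_apply_of_aemeasurable (hg.mono_ac (withDensity_absolutelyContinuous _ _)) hA,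
    withDensity_apply₀ _ (hg.nullMeasurable hA), withDensity_apply _ hA,
    Measure.restrict_map_of_aemeasurable hg hA, lintegral_map' hh.aemeasurable hg.restrict]
  rfl

theorem withDensity_div_const {α : Type*} [MeasurableSpace α] (m : Measure α) {h : α → ℝ≥0∞}
    (hh : Measurable h) (c : ℝ≥0∞) : m.withDensity (fun x => h x / c) = c⁻¹ • m.withDensity h := by
  simp_rw [ENNReal.div_eq_inv_mul]
  exact withDensity_smul _ hh

theorem hasLaw_prodMk_of_indepFun {Ω α β : Type*} [MeasurableSpace Ω] [MeasurableSpace α]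
    [MeasurableSpace β] {P : Measure Ω} [IsFiniteMeasure P] {X : Ω → α} {Y : Ω → β}
    {μ : Measure α} {ν : Measure β} (hX : HasLaw X μ P) (hY : HasLaw Y ν P) (h : IndepFun X Y P) :
    HasLaw (fun ω => (X ω, Y ω)) (μ.prod ν) P :=
  ⟨hX.aemeasurable.prodMk hY.aemeasurable, by
    rw [h.map_prod_eq_prod_map_map hX.aemeasurable hY.aemeasurable, hX.map_eq, hY.map_eq]⟩

theorem lintegral_processLaw_withDensity_const_mul {Ω E : Type*} [MeasurableSpace Ω]
    {P : Measure Ω} {X : E → Ω → ℝ≥0} (hX : AEMeasurable (fun ω x => X x ω) P) {g : Ω → ℝ≥0∞}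
    (hg : AEMeasurable g P) (c : ℝ≥0∞) {F : (E → ℝ≥0) → ℝ≥0∞} (hF : Measurable F) :
    ∫⁻ y, F y ∂(processLaw (P.withDensity fun ω => c * g ω) X)
      = c * ∫⁻ ω, g ω * F (fun x => X x ω) ∂P := by
  have hFX : AEMeasurable (fun ω => F fun x => X x ω) P := hF.comp_aemeasurable hX
  have hgF : AEMeasurable (fun ω => g ω * F fun x => X x ω) P := hg.mul hFX
  rw [processLaw, lintegral_map' hF.aemeasurable
    (hX.mono_ac (withDensity_absolutelyContinuous _ _)),
    lintegral_withDensity_eq_lintegral_mul₀ (hg.const_mul c) hFX,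
    ← lintegral_const_mul'' _ hgF]
  simp only [Pi.mul_apply, mul_assoc]

section SizeBias

variable {f : ℝ → ℝ≥0} {ρ : Measure ℝ≥0} {κ : ℝ≥0∞} {a : ℝ≥0} {θ : ℝ}

instance [SFinite ρ] : SFinite (sizeBiasedLaw κ ρ) := by
  unfold sizeBiasedLaw
  infer_instance

theorem withDensity_coe_eq_smul_sizeBiasedLaw (ρ : Measure ℝ≥0) (hκ0 : κ ≠ 0) (hκ : κ ≠ ∞) :
    (ρ.withDensity fun x => (x : ℝ≥0∞)) = κ • sizeBiasedLaw κ ρ := by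
  rw [sizeBiasedLaw, smul_smul, ENNReal.mul_inv_cancel hκ0 hκ, one_smul]

theorem smul_withDensity_inv_sizeBiasedLaw (hρ : ∀ᵐ x ∂ρ, x ≠ 0) (hκ0 : κ ≠ 0) (hκ : κ ≠ ∞) :
    (κ • (sizeBiasedLaw κ ρ).withDensity fun x => (x : ℝ≥0∞)⁻¹) = ρ := by
  rw [← withDensity_smul_measure, ← withDensity_coe_eq_smul_sizeBiasedLaw ρ hκ0 hκ]
  exact withDensity_inv_same measurable_coe_nnreal_ennreal
    (hρ.mono fun x hx => ENNReal.coe_ne_zero.2 hx) (.of_forall fun x => ENNReal.coe_ne_top)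

theorem isProbabilityMeasure_sizeBiasedLaw (hρ0 : ∫⁻ x, x ∂ρ ≠ 0) (hρ : ∫⁻ x, x ∂ρ ≠ ∞) :
    IsProbabilityMeasure (sizeBiasedLaw (∫⁻ x, x ∂ρ) ρ) := by
  constructor
  rw [sizeBiasedLaw, Measure.smul_apply, withDensity_apply _ .univ, setLIntegral_univ,
    smul_eq_mul, ENNReal.inv_mul_cancel hρ0 hρ]

theorem withDensity_sub_eq_smul_timeLaw (hf : Measurable f) (hfneg : ∀ u < 0, f u = 0)
    (hI0 : primitiveAt f a ≠ 0) (hI : primitiveAt f a ≠ ∞) :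
    ((volume.restrict (Ici 0)).withDensity fun s => (f (a - s) : ℝ≥0∞))
      = primitiveAt f a • timeLaw f a := by
  have htime : timeLaw f a = (primitiveAt f a)⁻¹ •
      (volume.restrict (Icc 0 (a : ℝ))).withDensity fun s => (f (a - s) : ℝ≥0∞) :=
    withDensity_div_const _ (by fun_prop) _
  rw [htime, smul_smul, ENNReal.mul_inv_cancel hI0 hI, one_smul]
  ext A hA
  rw [withDensity_apply _ hA, withDensity_apply _ hA, Measure.restrict_restrict hA,
    Measure.restrict_restrict hA, ← Ici_inter_Iic, ← inter_assoc,
    setLIntegral_inter_Iic_sub hfneg]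

theorem isProbabilityMeasure_timeLaw (hf : Measurable f) (hI0 : primitiveAt f a ≠ 0)
    (hI : primitiveAt f a ≠ ∞) : IsProbabilityMeasure (timeLaw f a) := by
  constructor
  rw [timeLaw, withDensity_apply _ .univ, setLIntegral_univ]
  simp_rw [ENNReal.div_eq_inv_mul]
  rw [lintegral_const_mul _ (by fun_prop), setLIntegral_Icc_sub, ENNReal.inv_mul_cancel hI0 hI]

theorem withDensity_eval_shiftLevy (hf : Measurable f) (hfneg : ∀ u < 0, f u = 0) [SFinite ρ]
    (hκ0 : κ ≠ 0) (hκ : κ ≠ ∞) (hI0 : primitiveAt f a ≠ 0) (hI : primitiveAt f a ≠ ∞) :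
    ((shiftLevy f univ ρ).withDensity fun y => (y a : ℝ≥0∞)) = (κ * primitiveAt f a) •
      ((timeLaw f a).prod (sizeBiasedLaw κ ρ)).map fun p => shiftPath f p.2 p.1 := by
  have hdens : ((volume.restrict (Ici 0)).prod ρ).withDensity
        ((fun y : ℝ≥0 → ℝ≥0 => (y a : ℝ≥0∞)) ∘ fun p : ℝ × ℝ≥0 => shiftPath f p.2 p.1)
      = (primitiveAt f a • timeLaw f a).prod (κ • sizeBiasedLaw κ ρ) := by
    rw [← withDensity_sub_eq_smul_timeLaw hf hfneg hI0 hI,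
      ← withDensity_coe_eq_smul_sizeBiasedLaw ρ hκ0 hκ,
      prod_withDensity (by fun_prop) (by fun_prop)]
    congr 1 with p
    simp [shiftPath, mul_comm]
  rw [shiftLevy, inter_univ, ← map_withDensity_comp (measurable_shiftPath hf).aemeasurable
    (by fun_prop), hdens, Measure.prod_smul_left, Measure.prod_smul_right, smul_smul,
    Measure.map_smul, mul_comm]

theorem smul_withDensity_exp_expMeasure (hθ : 0 < θ) :
    ((ENNReal.ofReal θ)⁻¹ • (expMeasure θ).withDensity fun y => ENNReal.ofReal (Real.exp (θ * y)))
      = volume.restrict (Ici 0) := by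
  have hpdf : Measurable (exponentialPDF θ) := (measurable_exponentialPDFReal θ).ennreal_ofReal
  have hprod : (exponentialPDF θ * fun y => ENNReal.ofReal (Real.exp (θ * y)))
      = (Ici 0).indicator fun _ => ENNReal.ofReal θ := by
    ext y
    rcases lt_or_ge y 0 with hy | hy
    · simp [exponentialPDF_of_neg hy, hy]
    · rw [Pi.mul_apply, exponentialPDF_of_nonneg hy, indicator_of_mem (mem_Ici.2 hy),
        ← ENNReal.ofReal_mul (by positivity), mul_assoc, ← Real.exp_add, neg_add_cancel,
        Real.exp_zero, mul_one]
  change _ • (volume.withDensity (exponentialPDF θ)).withDensity _ = _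
  rw [← withDensity_mul _ hpdf (by fun_prop), hprod, withDensity_indicator measurableSet_Ici,
    withDensity_const, smul_smul, ENNReal.inv_mul_cancel (ENNReal.ofReal_pos.2 hθ).ne'
    ENNReal.ofReal_ne_top, one_smul]

theorem map_withDensity_expMeasure_prod_sizeBiasedLaw (f : ℝ → ℝ≥0) [SFinite ρ]
    (hρ : ∀ᵐ x ∂ρ, x ≠ 0) (hκ0 : κ ≠ 0) (hκ : κ ≠ ∞) (hθ : 0 < θ) :
    (((expMeasure θ).prod (sizeBiasedLaw κ ρ)).withDensity fun p =>
      κ / ENNReal.ofReal θ * ((p.2 : ℝ≥0∞)⁻¹ * ENNReal.ofReal (Real.exp (θ * p.1)))).map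
        (fun p => shiftPath f p.2 p.1) = shiftLevy f univ ρ := by
  have : SFinite (expMeasure θ) := by unfold expMeasure gammaMeasure; infer_instance
  rw [shiftLevy, inter_univ, ← smul_withDensity_exp_expMeasure hθ]
  nth_rw 2 [← smul_withDensity_inv_sizeBiasedLaw hρ hκ0 hκ]
  rw [Measure.prod_smul_left, Measure.prod_smul_right, smul_smul,
    prod_withDensity (by fun_prop) (by fun_prop), ← withDensity_smul _ (by fun_prop)]
  congr 2 with p
  simp only [Pi.smul_apply, smul_eq_mul, ENNReal.div_eq_inv_mul]
  ring

theorem processLaw_withDensity_expMeasure_sizeBiasedLaw (hf : Measurable f) [SFinite ρ]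
    (hρ : ∀ᵐ x ∂ρ, x ≠ 0) (hκ0 : κ ≠ 0) (hκ : κ ≠ ∞) (hθ : 0 < θ) {Ω : Type*} [MeasurableSpace Ω]
    {P : Measure Ω} [IsFiniteMeasure P] {Y : Ω → ℝ} {V : Ω → ℝ≥0} (hY : HasLaw Y (expMeasure θ) P)
    (hV : HasLaw V (sizeBiasedLaw κ ρ) P) (hYV : IndepFun Y V P) :
    processLaw (P.withDensity fun ω => κ / ENNReal.ofReal θ *
      ((V ω : ℝ≥0∞)⁻¹ * ENNReal.ofReal (Real.exp (θ * Y ω))))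
        (fun (t : ℝ≥0) ω => V ω * f (t - Y ω)) = shiftLevy f univ ρ := by
  have hlaw := hasLaw_prodMk_of_indepFun hY hV hYV
  rw [← map_withDensity_expMeasure_prod_sizeBiasedLaw f hρ hκ0 hκ hθ, ← hlaw.map_eq,
    ← map_withDensity_comp hlaw.aemeasurable (by fun_prop),
    AEMeasurable.map_map_of_aemeasurable (measurable_shiftPath hf).aemeasurable
      (hlaw.aemeasurable.mono_ac (withDensity_absolutelyContinuous _ _))]
  rfl

end SizeBias

namespace Subordinator

variable {Ω : Type*} [MeasurableSpace Ω] {P : Measure Ω} [IsProbabilityMeasure P]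
  (Z : Subordinator P) {f : ℝ → ℝ≥0} {ρ : Measure ℝ≥0}

theorem processLaw_conv_withDensity_eval (hρ : IsDriftlessLevyMeasure ρ (P.map (Z.val 1)))
    (hκ0 : Z.mean ≠ 0) (hκ : Z.mean ≠ ∞) (hf : Measurable f) (hfneg : ∀ u < 0, f u = 0)
    (hfint : ∀ r, primitiveAt f r ≠ ∞) {a : ℝ≥0} (hI0 : primitiveAt f a ≠ 0) :
    (processLaw P (Z.conv f)).withDensity (fun z => (z a : ℝ≥0∞))
      = (Z.mean * primitiveAt f a) • (processLaw P (Z.conv f)).conv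
        (((timeLaw f a).prod (sizeBiasedLaw Z.mean ρ)).map fun p => shiftPath f p.2 p.1) := by
  have hm : ∫⁻ x, x ∂ρ ≠ ∞ := by rwa [← Z.mean_eq_lintegral hρ]
  have := hρ.sFinite hm
  have := isProbabilityMeasure_timeLaw hf hI0 (hfint a)
  have hlevy : HasLevyLaplace (shiftLevy f univ ρ) (processLaw P (Z.conv f)) :=
    Z.hasLevyLaplace_convOn hρ hκ hf hfneg hfint .univ
  have := hlevy.isProbabilityMeasure
  rw [hlevy.withDensity_eval (lintegral_eval_shiftLevy_ne_top hf hfneg hm univ (hfint a)),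
    withDensity_eval_shiftLevy hf hfneg hκ0 hκ hI0 (hfint a), Measure.conv_comm,
    Measure.conv_smul_left, Measure.conv_comm]

theorem processLaw_add_eq_withDensity (hρ : IsDriftlessLevyMeasure ρ (P.map (Z.val 1)))
    (hκ0 : Z.mean ≠ 0) (hκ : Z.mean ≠ ∞) (hf : Measurable f) (hfneg : ∀ u < 0, f u = 0)
    (hfint : ∀ r, primitiveAt f r ≠ ∞) {a : ℝ≥0} (hI0 : primitiveAt f a ≠ 0) {U : Ω → ℝ}
    {V : Ω → ℝ≥0} (hU : HasLaw U (timeLaw f a) P) (hV : HasLaw V (sizeBiasedLaw Z.mean ρ) P)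
    (hUV : IndepFun U V P) (hUVψ : IndepFun (fun ω => (U ω, V ω)) (fun ω t => Z.conv f t ω) P) :
    processLaw P (fun t ω => Z.conv f t ω + V ω * f (t - U ω)) =
      processLaw (P.withDensity fun ω => Z.conv f a ω / (Z.mean * primitiveAt f a))
        (Z.conv f) := by
  have hψ : Measurable fun ω t => Z.conv f t ω := Z.measurable_convOn hf .univ
  have hpath := measurable_shiftPath hf
  have hUVlaw := hasLaw_prodMk_of_indepFun hU hV hUV
  calc processLaw P (fun t ω => Z.conv f t ω + V ω * f (t - U ω))
      = (processLaw P (Z.conv f)).conv (P.map fun ω => shiftPath f (V ω) (U ω)) :=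
        (hUVψ.symm.comp measurable_id hpath).map_add_eq_map_conv_map₀ hψ.aemeasurable
          (hpath.comp_aemeasurable hUVlaw.aemeasurable)
    _ = (processLaw P (Z.conv f)).conv
          (((timeLaw f a).prod (sizeBiasedLaw Z.mean ρ)).map fun p => shiftPath f p.2 p.1) := by
        rw [← hUVlaw.map_eq,
          AEMeasurable.map_map_of_aemeasurable hpath.aemeasurable hUVlaw.aemeasurable]
        rfl
    _ = (processLaw P (Z.conv f)).withDensity
          (fun z => z a / (Z.mean * primitiveAt f a)) := by
        rw [withDensity_div_const _ (by fun_prop),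
          Z.processLaw_conv_withDensity_eval hρ hκ0 hκ hf hfneg hfint hI0, smul_smul,
          ENNReal.inv_mul_cancel (mul_ne_zero hκ0 hI0) (ENNReal.mul_ne_top hκ (hfint a)), one_smul]
    _ = processLaw (P.withDensity fun ω => Z.conv f a ω / (Z.mean * primitiveAt f a))
          (Z.conv f) :=
        (map_withDensity_comp hψ.aemeasurable (by fun_prop)).symm

end Subordinator

/-! ### The Lévy measure as a reweighted law -/

theorem primitiveAt_ne_top {f : ℝ → ℝ≥0} (hfint : ∀ t : ℝ≥0, 0 < t → primitiveAt f t < ∞)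
    (t : ℝ≥0) : primitiveAt f t ≠ ∞ := by
  rcases eq_or_ne t 0 with rfl | ht
  · simp [primitiveAt]
  · exact (hfint t (pos_iff_ne_zero.2 ht)).ne

theorem IsProcessLevyMeasure.iff_lintegral_eq {E : Type*} {ν₀ μ : Measure (E → ℝ≥0)}
    (h : IsProcessLevyMeasure ν₀ μ) {Φ : ((E → ℝ≥0) → ℝ≥0∞) → ℝ≥0∞}
    (hΦ : ∀ F, Measurable F → ∫⁻ y, F y ∂ν₀ = Φ F) (ν : Measure (E → ℝ≥0)) :
    IsProcessLevyMeasure ν μ ↔ ∀ F, Measurable F → ∫⁻ y, F y ∂ν = Φ F := by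
  refine ⟨fun hν => by rwa [hν.unique h], fun hν => ?_⟩
  have hνν₀ : ν = ν₀ := Measure.ext_of_lintegral _ fun F hF => (hν F hF).trans (hΦ F hF).symm
  rwa [hνν₀]

namespace Subordinator

variable {Ω : Type*} [MeasurableSpace Ω] {P : Measure Ω} [IsProbabilityMeasure P]
  (Z : Subordinator P) {f : ℝ → ℝ≥0} {D : Set ℝ} {ρ : Measure ℝ≥0}

theorem isProcessLevyMeasure_convOn (hρ : IsDriftlessLevyMeasure ρ (P.map (Z.val 1)))
    (hκ : Z.mean ≠ ∞) (hf : Measurable f) (hfneg : ∀ u < 0, f u = 0)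
    (hfint : ∀ r, primitiveAt f r ≠ ∞) (hf0 : ¬ f =ᵐ[volume] 0) (hD : MeasurableSet D) :
    IsProcessLevyMeasure (shiftLevy f D ρ) (processLaw P (Z.convOn f D)) := by
  have := hρ.sFinite (by rwa [← Z.mean_eq_lintegral hρ])
  obtain ⟨J, hJ, hae⟩ := exists_countable_ae_shiftLevy_ne_zero hf hfneg hρ.ae_ne_zero hf0 D
  exact (Z.hasLevyLaplace_convOn hρ hκ hf hfneg hfint hD).isProcessLevyMeasure hJ hae

theorem isProcessLevyMeasure_convOn_iff (hρ : IsDriftlessLevyMeasure ρ (P.map (Z.val 1)))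
    (hκ : Z.mean ≠ ∞) (hf : Measurable f) (hfneg : ∀ u < 0, f u = 0)
    (hfint : ∀ r, primitiveAt f r ≠ ∞) (hf0 : ¬ f =ᵐ[volume] 0) (hD : MeasurableSet D)
    (hD0 : D ⊆ Ici 0) (ν : Measure (ℝ≥0 → ℝ≥0)) :
    IsProcessLevyMeasure ν (processLaw P (Z.convOn f D)) ↔
      ∀ F : (ℝ≥0 → ℝ≥0) → ℝ≥0∞, Measurable F →
        ∫⁻ y, F y ∂ν = ∫⁻ s in D, ∫⁻ x, F (shiftPath f x s) ∂ρ := by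
  have := hρ.sFinite (by rwa [← Z.mean_eq_lintegral hρ])
  refine (Z.isProcessLevyMeasure_convOn hρ hκ hf hfneg hfint hf0 hD).iff_lintegral_eq
    (Φ := fun F => ∫⁻ s in D, ∫⁻ x, F (shiftPath f x s) ∂ρ) (fun F hF => ?_) ν
  rw [lintegral_shiftLevy hf D hF, inter_eq_right.2 hD0]

section Representation

variable {θ : ℝ} {Ω' : Type*} [MeasurableSpace Ω'] {P' : Measure Ω'} [IsFiniteMeasure P']
  {Y : Ω' → ℝ} {V : Ω' → ℝ≥0}

theorem isProcessLevyMeasure_processLaw_withDensity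
    (hρ : IsDriftlessLevyMeasure ρ (P.map (Z.val 1))) (hκ0 : Z.mean ≠ 0) (hκ : Z.mean ≠ ∞)
    (hf : Measurable f) (hfneg : ∀ u < 0, f u = 0) (hfint : ∀ r, primitiveAt f r ≠ ∞)
    (hf0 : ¬ f =ᵐ[volume] 0) (hθ : 0 < θ) (hY : HasLaw Y (expMeasure θ) P')
    (hV : HasLaw V (sizeBiasedLaw Z.mean ρ) P') (hYV : IndepFun Y V P') :
    IsProcessLevyMeasure
      (processLaw (P'.withDensity fun ω => Z.mean / ENNReal.ofReal θ *
        ((V ω : ℝ≥0∞)⁻¹ * ENNReal.ofReal (Real.exp (θ * Y ω))))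
          (fun (t : ℝ≥0) ω => V ω * f (t - Y ω)))
      (processLaw P (Z.conv f)) := by
  have := hρ.sFinite (by rwa [← Z.mean_eq_lintegral hρ])
  rw [processLaw_withDensity_expMeasure_sizeBiasedLaw hf hρ.ae_ne_zero hκ0 hκ hθ hY hV hYV]
  exact Z.isProcessLevyMeasure_convOn hρ hκ hf hfneg hfint hf0 .univ

theorem isProcessLevyMeasure_conv_iff_lintegral_expMeasure
    (hρ : IsDriftlessLevyMeasure ρ (P.map (Z.val 1))) (hκ0 : Z.mean ≠ 0) (hκ : Z.mean ≠ ∞)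
    (hf : Measurable f) (hfneg : ∀ u < 0, f u = 0) (hfint : ∀ r, primitiveAt f r ≠ ∞)
    (hf0 : ¬ f =ᵐ[volume] 0) (hθ : 0 < θ) (hY : HasLaw Y (expMeasure θ) P')
    (hV : HasLaw V (sizeBiasedLaw Z.mean ρ) P') (hYV : IndepFun Y V P')
    (ν : Measure (ℝ≥0 → ℝ≥0)) :
    IsProcessLevyMeasure ν (processLaw P (Z.conv f)) ↔
      ∀ F : (ℝ≥0 → ℝ≥0) → ℝ≥0∞, Measurable F →
        ∫⁻ y, F y ∂ν = Z.mean / ENNReal.ofReal θ *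
          ∫⁻ ω, (V ω : ℝ≥0∞)⁻¹ * ENNReal.ofReal (Real.exp (θ * Y ω)) *
            F (shiftPath f (V ω) (Y ω)) ∂P' := by
  have hVm := hV.aemeasurable
  have hYm := hY.aemeasurable
  exact (Z.isProcessLevyMeasure_processLaw_withDensity hρ hκ0 hκ hf hfneg hfint hf0 hθ hY hV
    hYV).iff_lintegral_eq (fun F hF => lintegral_processLaw_withDensity_const_mul
      ((measurable_shiftPath hf).comp_aemeasurable (hYm.prodMk hVm)) (by fun_prop) _ hF) ν

end Representation

end Subordinator

/-! ### Conditioning on a zero -/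

theorem HasLevyLaplace.eq_conv_of_add {E : Type*} {ν₁ ν₂ μ μ₁ μ₂ : Measure (E → ℝ≥0)}
    (h : HasLevyLaplace (ν₁ + ν₂) μ) (h₁ : HasLevyLaplace ν₁ μ₁) (h₂ : HasLevyLaplace ν₂ μ₂) :
    μ = μ₁.conv μ₂ := by
  have := h.isProbabilityMeasure
  have := h₁.isProbabilityMeasure
  have := h₂.isProbabilityMeasure
  refine ext_of_laplace fun n x α => ?_
  rw [integral_exp_neg_evalSum_conv, h.laplace, h₁.laplace, h₂.laplace, ← Real.exp_add, ← neg_add,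
    integral_add_measure (h₁.integrable_one_sub_exp_neg_evalSum x α)
      (h₂.integrable_one_sub_exp_neg_evalSum x α)]

theorem measurableSet_zeroTimes {f : ℝ → ℝ≥0} (hf : Measurable f) (a : ℝ≥0) :
    MeasurableSet (zeroTimes f a) :=
  measurableSet_Ici.inter
    (measurableSet_eq_fun (hf.comp (measurable_const_sub (a : ℝ))) measurable_const)

theorem setLIntegral_shiftLevy_eval_eq_zero {f : ℝ → ℝ≥0} {ρ : Measure ℝ≥0} (hf : Measurable f)
    [SFinite ρ] (a t : ℝ≥0) :
    ∫⁻ y in {y | y a = 0}, y t ∂(shiftLevy f (Ici 0 \ zeroTimes f a) ρ) = 0 := by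
  have hset : MeasurableSet {y : ℝ≥0 → ℝ≥0 | y a = 0} :=
    measurableSet_eq_fun (measurable_pi_apply a) measurable_const
  rw [← lintegral_indicator hset, lintegral_shiftLevy hf _ (.indicator (by fun_prop) hset)]
  refine setLIntegral_eq_zero (measurableSet_Ici.inter
    (measurableSet_Ici.diff (measurableSet_zeroTimes hf a))) fun s hs => ?_
  have hne : f (a - s) ≠ 0 := fun h => hs.2.2 ⟨hs.1, h⟩
  refine (lintegral_congr fun x => indicator_apply_eq_zero.2 fun hx => ?_).trans lintegral_zero
  have hx0 : x = 0 := (mul_eq_zero.1 (show x * f (a - s) = 0 from hx)).resolve_right hne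
  simp [shiftPath, hx0]

namespace Subordinator

variable {Ω : Type*} [MeasurableSpace Ω] {P : Measure Ω} (Z : Subordinator P) {f : ℝ → ℝ≥0}
  {ρ : Measure ℝ≥0}

theorem convOn_zeroTimes_self (hf : Measurable f) (a : ℝ≥0) (ω : Ω) :
    Z.convOn f (zeroTimes f a) a ω = 0 := by
  rw [convOn, setLIntegral_eq_zero (measurableSet_Ioc.inter (measurableSet_zeroTimes hf a))
    fun s hs => by simp [hs.2.2], ENNReal.toNNReal_zero]

variable [IsProbabilityMeasure P]

theorem processLaw_conv_eq_conv (hρ : IsDriftlessLevyMeasure ρ (P.map (Z.val 1)))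
    (hκ : Z.mean ≠ ∞) (hf : Measurable f) (hfneg : ∀ u < 0, f u = 0)
    (hfint : ∀ r, primitiveAt f r ≠ ∞) {D : Set ℝ} (hD : MeasurableSet D) :
    processLaw P (Z.conv f)
      = (processLaw P (Z.convOn f D)).conv (processLaw P (Z.convOn f (Ici 0 \ D))) := by
  have := hρ.sFinite (by rwa [← Z.mean_eq_lintegral hρ])
  refine HasLevyLaplace.eq_conv_of_add ?_ (Z.hasLevyLaplace_convOn hρ hκ hf hfneg hfint hD)
    (Z.hasLevyLaplace_convOn hρ hκ hf hfneg hfint (measurableSet_Ici.diff hD))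
  rw [← shiftLevy_univ_eq_add hf hD]
  exact Z.hasLevyLaplace_convOn hρ hκ hf hfneg hfint .univ

theorem isCondLawAtZero_convOn_zeroTimes (hρ : IsDriftlessLevyMeasure ρ (P.map (Z.val 1)))
    (hκ : Z.mean ≠ ∞) (hf : Measurable f) (hfneg : ∀ u < 0, f u = 0)
    (hfint : ∀ r, primitiveAt f r ≠ ∞) (a : ℝ≥0) :
    IsCondLawAtZero (processLaw P (Z.conv f)) a (processLaw P (Z.convOn f (zeroTimes f a))) := by
  have hm : ∫⁻ x, x ∂ρ ≠ ∞ := by rwa [← Z.mean_eq_lintegral hρ]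
  have := hρ.sFinite hm
  have hD := measurableSet_zeroTimes hf a
  have hψ := (Z.measurable_convOn hf hD).aemeasurable (μ := P)
  have : IsProbabilityMeasure (processLaw P (Z.convOn f (zeroTimes f a))) :=
    Measure.isProbabilityMeasure_map hψ
  rw [Z.processLaw_conv_eq_conv hρ hκ hf hfneg hfint hD]
  refine HasLevyLaplace.isCondLawAtZero_conv
    (Z.hasLevyLaplace_convOn hρ hκ hf hfneg hfint (measurableSet_Ici.diff hD))
    (fun t => lintegral_eval_shiftLevy_ne_top hf hfneg hm _ (hfint t)) ?_
    (setLIntegral_shiftLevy_eval_eq_zero hf a)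
  rw [processLaw, ae_map_iff hψ (measurableSet_eq_fun (measurable_pi_apply a) measurable_const)]
  exact .of_forall (Z.convOn_zeroTimes_self hf a)

theorem isCondLawAtZero_and_eq_conv_iff (hρ : IsDriftlessLevyMeasure ρ (P.map (Z.val 1)))
    (hκ : Z.mean ≠ ∞) (hf : Measurable f) (hfneg : ∀ u < 0, f u = 0)
    (hfint : ∀ r, primitiveAt f r ≠ ∞) (a : ℝ≥0) {Q R : Measure (ℝ≥0 → ℝ≥0)} [IsFiniteMeasure Q]
    [IsFiniteMeasure R] :
    (IsCondLawAtZero (processLaw P (Z.conv f)) a Q ∧ processLaw P (Z.conv f) = Q.conv R) ↔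
      Q = processLaw P (Z.convOn f (zeroTimes f a)) ∧
        R = processLaw P (Z.convOn f (Ici 0 \ zeroTimes f a)) := by
  have hD := measurableSet_zeroTimes hf a
  have hD' : MeasurableSet (Ici (0 : ℝ) \ zeroTimes f a) := measurableSet_Ici.diff hD
  have hlevy := Z.hasLevyLaplace_convOn hρ hκ hf hfneg hfint hD
  have := hlevy.isProbabilityMeasure
  have := (Z.hasLevyLaplace_convOn hρ hκ hf hfneg hfint hD').isProbabilityMeasure
  have hcond := Z.isCondLawAtZero_convOn_zeroTimes hρ hκ hf hfneg hfint a
  have hconv := Z.processLaw_conv_eq_conv hρ hκ hf hfneg hfint hD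
  constructor
  · rintro ⟨hQ, hQR⟩
    obtain rfl := hQ.unique hcond
    exact ⟨rfl, hlevy.conv_left_cancel (hQR.symm.trans hconv)⟩
  · rintro ⟨rfl, rfl⟩
    exact ⟨hcond, hconv⟩

end Subordinator

theorem mainTheorem6_general {Ω : Type*} [MeasurableSpace Ω] (P : Measure Ω)
    [IsProbabilityMeasure P] (Z : Subordinator P) (ρ : Measure ℝ≥0)
    (hρ : IsDriftlessLevyMeasure ρ (P.map (Z.val 1)))
    (hκ0 : 0 < Z.mean) (hκ : Z.mean < ∞)
    (f : ℝ → ℝ≥0) (hf : Measurable f) (hfneg : ∀ u < 0, f u = 0)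
    (hfint : ∀ t : ℝ≥0, 0 < t → primitiveAt f t < ∞) :
    IsProbabilityMeasure (sizeBiasedLaw Z.mean ρ) ∧
    (∀ a : ℝ≥0, 0 < primitiveAt f a →
      IsProbabilityMeasure (timeLaw f a) ∧
      ∀ (U : Ω → ℝ) (V : Ω → ℝ≥0),
        HasLaw U (timeLaw f a) P → HasLaw V (sizeBiasedLaw Z.mean ρ) P →
        IndepFun U V P →
        IndepFun (fun ω => (U ω, V ω)) (fun ω t => Z.conv f t ω) P →
        processLaw P (fun t ω => Z.conv f t ω + V ω * f (t - U ω)) =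
          processLaw
            (P.withDensity fun ω => Z.conv f a ω / (Z.mean * primitiveAt f a)) (Z.conv f)) ∧
    ((∃ a, 0 < primitiveAt f a) → ∀ θ : ℝ, 0 < θ →
      ∀ {Ω' : Type*} [MeasurableSpace Ω'] (P' : Measure Ω') [IsProbabilityMeasure P']
        (Y : Ω' → ℝ) (V : Ω' → ℝ≥0),
        HasLaw Y (expMeasure θ) P' → HasLaw V (sizeBiasedLaw Z.mean ρ) P' →
        IndepFun Y V P' →
        (∀ ν : Measure (ℝ≥0 → ℝ≥0), IsProcessLevyMeasure ν (processLaw P (Z.conv f)) ↔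
          ∀ F : (ℝ≥0 → ℝ≥0) → ℝ≥0∞, Measurable F →
            ∫⁻ y, F y ∂ν = Z.mean / ENNReal.ofReal θ *
              ∫⁻ ω, (V ω : ℝ≥0∞)⁻¹ * ENNReal.ofReal (Real.exp (θ * Y ω)) *
                F (shiftPath f (V ω) (Y ω)) ∂P') ∧
        IsProcessLevyMeasure
          (processLaw
            (P'.withDensity fun ω => Z.mean / ENNReal.ofReal θ *
              ((V ω : ℝ≥0∞)⁻¹ * ENNReal.ofReal (Real.exp (θ * Y ω))))
            (fun (t : ℝ≥0) ω => V ω * f (t - Y ω)))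
          (processLaw P (Z.conv f))) ∧
    (∀ a : ℝ≥0,
      (∀ Q R : Measure (ℝ≥0 → ℝ≥0), IsProbabilityMeasure Q → IsProbabilityMeasure R →
        ((IsCondLawAtZero (processLaw P (Z.conv f)) a Q ∧
            processLaw P (Z.conv f) = Q.conv R) ↔
          (Q = processLaw P (Z.convOn f (zeroTimes f a)) ∧
            R = processLaw P (Z.convOn f (Ici 0 \ zeroTimes f a))))) ∧
      IsProbabilityMeasure (processLaw P (Z.convOn f (zeroTimes f a))) ∧
      IsProbabilityMeasure (processLaw P (Z.convOn f (Ici 0 \ zeroTimes f a))) ∧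
      IsInfDivLaw (processLaw P (Z.convOn f (zeroTimes f a))) ∧
      IsInfDivLaw (processLaw P (Z.convOn f (Ici 0 \ zeroTimes f a))) ∧
      ((∃ b, 0 < primitiveAt f b) →
        (∀ ν : Measure (ℝ≥0 → ℝ≥0),
          IsProcessLevyMeasure ν (processLaw P (Z.convOn f (zeroTimes f a))) ↔
          ∀ F : (ℝ≥0 → ℝ≥0) → ℝ≥0∞, Measurable F →
            ∫⁻ y, F y ∂ν = ∫⁻ s in zeroTimes f a, ∫⁻ x, F (shiftPath f x s) ∂ρ) ∧
        (∀ ν : Measure (ℝ≥0 → ℝ≥0),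
          IsProcessLevyMeasure ν
            (processLaw P (Z.convOn f (Ici 0 \ zeroTimes f a))) ↔
          ∀ F : (ℝ≥0 → ℝ≥0) → ℝ≥0∞, Measurable F →
            ∫⁻ y, F y ∂ν =
              ∫⁻ s in Ici 0 \ zeroTimes f a, ∫⁻ x, F (shiftPath f x s) ∂ρ))) := by
  have hI := primitiveAt_ne_top hfint
  have hf0 : (∃ a, 0 < primitiveAt f a) → ¬ f =ᵐ[volume] 0 :=
    fun ⟨_, ha⟩ => not_ae_eq_zero_of_primitiveAt_pos ha
  have hmean := Z.mean_eq_lintegral hρ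
  refine ⟨hmean ▸ isProbabilityMeasure_sizeBiasedLaw (hmean ▸ hκ0.ne') (hmean ▸ hκ.ne),
    fun a ha => ⟨isProbabilityMeasure_timeLaw hf ha.ne' (hI a), fun U V hU hV hUV hUVψ =>
      Z.processLaw_add_eq_withDensity hρ hκ0.ne' hκ.ne hf hfneg hI ha.ne' hU hV hUV hUVψ⟩,
    fun hpos θ hθ Ω' _ P' _ Y V hY hV hYV =>
      ⟨Z.isProcessLevyMeasure_conv_iff_lintegral_expMeasure hρ hκ0.ne' hκ.ne hf hfneg hI
        (hf0 hpos) hθ hY hV hYV,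
      Z.isProcessLevyMeasure_processLaw_withDensity hρ hκ0.ne' hκ.ne hf hfneg hI
        (hf0 hpos) hθ hY hV hYV⟩,
    fun a => ?_⟩
  have hD := measurableSet_zeroTimes hf a
  have hD' : MeasurableSet (Ici (0 : ℝ) \ zeroTimes f a) := measurableSet_Ici.diff hD
  exact ⟨fun Q R _ _ => Z.isCondLawAtZero_and_eq_conv_iff hρ hκ.ne hf hfneg hI a,
    (Z.hasLevyLaplace_convOn hρ hκ.ne hf hfneg hI hD).isProbabilityMeasure,
    (Z.hasLevyLaplace_convOn hρ hκ.ne hf hfneg hI hD').isProbabilityMeasure,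
    Z.isInfDivLaw_convOn hρ hκ.ne hf hfneg hI hD,
    Z.isInfDivLaw_convOn hρ hκ.ne hf hfneg hI hD',
    fun hpos => ⟨Z.isProcessLevyMeasure_convOn_iff hρ hκ.ne hf hfneg hI (hf0 hpos) hD
        fun _ hs => hs.1,
      Z.isProcessLevyMeasure_convOn_iff hρ hκ.ne hf hfneg hI (hf0 hpos) hD' sdiff_subset⟩⟩

theorem mainTheorem6 {Ω : Type*} [MeasurableSpace Ω] (P : Measure Ω)
    [IsProbabilityMeasure P] (Z : Subordinator P) (ρ : Measure ℝ≥0)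
    (hρ : IsDriftlessLevyMeasure ρ (P.map (Z.val 1)))
    (hκ0 : 0 < Z.mean) (hκ : Z.mean < ∞)
    (f : ℝ → ℝ≥0) (hf : Measurable f) (hfneg : ∀ u < 0, f u = 0)
    (hfint : ∀ t : ℝ≥0, 0 < t → primitiveAt f t < ∞) :
    IsProbabilityMeasure (sizeBiasedLaw Z.mean ρ) ∧
    -- size-bias identity
    (∀ a : ℝ≥0, 0 < a → 0 < primitiveAt f a →
      IsProbabilityMeasure (timeLaw f a) ∧
      ∀ (U : Ω → ℝ) (V : Ω → ℝ≥0),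
        HasLaw U (timeLaw f a) P → HasLaw V (sizeBiasedLaw Z.mean ρ) P →
        IndepFun U V P →
        IndepFun (fun ω => (U ω, V ω)) (fun ω t => Z.conv f t ω) P →
        processLaw P (fun t ω => Z.conv f t ω + V ω * f (t - U ω)) =
          processLaw
            (P.withDensity fun ω => Z.conv f a ω / (Z.mean * primitiveAt f a)) (Z.conv f)) ∧
    -- representation of the Lévy measure
    ((∃ a, 0 < primitiveAt f a) → ∀ θ : ℝ, 0 < θ →
      ∫⁻ s in Ici 0, ENNReal.ofReal (Real.exp (-θ * s)) * f s < ∞ →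
      ∀ {Ω' : Type*} [MeasurableSpace Ω'] (P' : Measure Ω') [IsProbabilityMeasure P']
        (Y : Ω' → ℝ) (V : Ω' → ℝ≥0),
        HasLaw Y (expMeasure θ) P' → HasLaw V (sizeBiasedLaw Z.mean ρ) P' →
        IndepFun Y V P' →
        (∀ ν : Measure (ℝ≥0 → ℝ≥0), IsProcessLevyMeasure ν (processLaw P (Z.conv f)) ↔
          ∀ F : (ℝ≥0 → ℝ≥0) → ℝ≥0∞, Measurable F →
            ∫⁻ y, F y ∂ν = Z.mean / ENNReal.ofReal θ *
              ∫⁻ ω, (V ω : ℝ≥0∞)⁻¹ * ENNReal.ofReal (Real.exp (θ * Y ω)) *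
                F (shiftPath f (V ω) (Y ω)) ∂P') ∧
        IsProcessLevyMeasure
          (processLaw
            (P'.withDensity fun ω => Z.mean / ENNReal.ofReal θ *
              ((V ω : ℝ≥0∞)⁻¹ * ENNReal.ofReal (Real.exp (θ * Y ω))))
            (fun (t : ℝ≥0) ω => V ω * f (t - Y ω)))
          (processLaw P (Z.conv f))) ∧
    -- conditioning decomposition
    (∀ a : ℝ≥0,
      (∀ Q R : Measure (ℝ≥0 → ℝ≥0), IsProbabilityMeasure Q → IsProbabilityMeasure R →
        ((IsCondLawAtZero (processLaw P (Z.conv f)) a Q ∧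
            processLaw P (Z.conv f) = Q.conv R) ↔
          (Q = processLaw P (Z.convOn f (zeroTimes f a)) ∧
            R = processLaw P (Z.convOn f (Ici 0 \ zeroTimes f a))))) ∧
      IsProbabilityMeasure (processLaw P (Z.convOn f (zeroTimes f a))) ∧
      IsProbabilityMeasure (processLaw P (Z.convOn f (Ici 0 \ zeroTimes f a))) ∧
      IsInfDivLaw (processLaw P (Z.convOn f (zeroTimes f a))) ∧
      IsInfDivLaw (processLaw P (Z.convOn f (Ici 0 \ zeroTimes f a))) ∧
      ((∃ b, 0 < primitiveAt f b) →
        (∀ ν : Measure (ℝ≥0 → ℝ≥0),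
          IsProcessLevyMeasure ν (processLaw P (Z.convOn f (zeroTimes f a))) ↔
          ∀ F : (ℝ≥0 → ℝ≥0) → ℝ≥0∞, Measurable F →
            ∫⁻ y, F y ∂ν = ∫⁻ s in zeroTimes f a, ∫⁻ x, F (shiftPath f x s) ∂ρ) ∧
        (∀ ν : Measure (ℝ≥0 → ℝ≥0),
          IsProcessLevyMeasure ν
            (processLaw P (Z.convOn f (Ici 0 \ zeroTimes f a))) ↔
          ∀ F : (ℝ≥0 → ℝ≥0) → ℝ≥0∞, Measurable F →
            ∫⁻ y, F y ∂ν =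
              ∫⁻ s in Ici 0 \ zeroTimes f a, ∫⁻ x, F (shiftPath f x s) ∂ρ))) := by
  obtain ⟨hV, hbias, hlevy, hcond⟩ := mainTheorem6_general P Z ρ hρ hκ0 hκ f hf hfneg hfint
  exact ⟨hV, fun a _ => hbias a, fun hpos θ hθ _ => hlevy hpos θ hθ, hcond⟩
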